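/- \textbf{Multi-agent path finding.} An instance $M=(G,R,\{s_r,t_r\}_{r\in R})$ consists of an undirected graph $G=(V,E)$, a finite set $R$ of agents, and a start vertex $s_r$ and a target vertex $t_r$ for each agent. A motion plan gives each agent $r$ a trajectory $\pi_r:\mathbb N\to V$ with $\pi_r(0)=s_r$, $\pi_r(\tau)=t_r$ for all large $\tau$, and $\pi_r(\tau-1)=\pi_r(\tau)$ or $\{\pi_r(\tau-1),\pi_r(\tau)\}\in E$ for all $\tau>0$. It is collision-free if for all $r\ne r'$: $\pi_r(\tau)\ne\pi_{r'}(\tau)$ for all $\tau\ge 0$, and $(\pi_r(\tau-1),\pi_r(\tau))\ne(\pi_{r'}(\tau),\pi_{r'}(\tau-1))$ for all $\tau>0$. (Such plans are parallel: agents may move simultaneously, also synchronously along a cycle.) It is sequential if at most one agent moves in each time step. Its distance cost is the sum over the agents of the number of edges of the agent's path (the trajectory with consecutive repetitions removed). Let $d^*(M)=\sum_{r\in R}d_G(s_r,t_r)$. \textbf{The instance $M'$.} Let $\phi$ be a 3-CNF formula with variables $v_1,\dots,v_N$ and $m$ clauses of three literals each. Let $s_v$ be the larger one of the numbers of appearances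 of $v$ and of $\overline v$ in $\phi$. The graph $G$ is the grid graph (cells sharing a side are adjacent) on the non-obstacle cells of a grid with three rows (bottom, middle, top), composed from left to right as follows. (i) A room of $\lfloor (m-1)/3\rfloor+1$ columns (one column if $m=0$), all of whose cells are free. Each clause has one clause agent, and the clause agents start at arbitrary distinct cells of the room. (ii) The variable gadgets, one for each variable, in arbitrary order. The gadget of $v$ has columns $0,1,\dots,s_v+5$. Columns $0$, $2$ and $s_v+4$ are free; column $1$ is free only in the top row (the entrance); columns $3,\dots,s_v+3$ are free in the top and bottom rows; column $s_v+5$ is free only in the bottom row (the exit). Column $0$ of the leftmost gadget is the last column of the room; column $0$ of every other gadget directly follows the exit column of the preceding gadget. Each appearance of a literal in $\phi$ has one literal agent. The agents of the appearances of $v$ start at distinct, otherwise arbitrary cells of columns $4,\dots,s_v+3$ in the top row, and those of the appearances of $\overline v$ at distinct, otherwise arbitrary cells of these columns in the bottom row. In addition, each variable gadget has one blocker agent, which starts at the gadget's entrance and has the gadget's exit as its target. (iii) The clause gadgets, one for each clause, in arbitrary order, directly after the exit of the last variable gadget. Each has columns $0,\dots,6$. Columns $0,2,4,5$ are free, columns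 $1$ and $3$ are free except in the middle row, and column $6$ is free only in the bottom row. The middle cells of columns $0,2,4$ are the targets of the agents of the clause's three literals, in arbitrary order; the top cell of column $4$ is the target of the clause's agent. \textbf{Theorem.} For every 3-CNF formula $\phi$ and all choices in the construction of $M'$, the instance $M'$ has a collision-free motion plan of distance cost $d^*(M')$ if and only if $\phi$ is satisfiable. Likewise, $M'$ has a sequential collision-free motion plan of distance cost $d^*(M')$ if and only if $\phi$ is satisfiable. -/

import Mathlib

/-! ### Multi-agent path finding -/

/-- An instance of multi-agent path finding: an undirected graph on `V`, and for every agent in `R`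
a start vertex and a target vertex. -/
structure MAPF (V R : Type) where
  graph : SimpleGraph V
  src : R → V
  trg : R → V

namespace MAPF

variable {V R : Type}

/-- A feasible trajectory (timed path) from `s` to `t`. -/
def IsTrajectory (G : SimpleGraph V) (s t : V) (p : ℕ → V) : Prop :=
  p 0 = s ∧ (∃ T, ∀ τ, T ≤ τ → p τ = t) ∧ ∀ τ, p τ = p (τ + 1) ∨ G.Adj (p τ) (p (τ + 1))

/-- A motion plan: one feasible trajectory for every agent. -/
def IsMotionPlan (M : MAPF V R) (p : R → ℕ → V) : Prop :=
  ∀ r, IsTrajectory M.graph (M.src r) (M.trg r) (p r)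

/-- No two agents are ever on the same vertex, and no two agents ever swap along an edge.
Agents may move in parallel, follow each other like a train, and rotate along cycles. -/
def CollisionFree (p : R → ℕ → V) : Prop :=
  ∀ r r', r ≠ r' →
    (∀ τ, p r τ ≠ p r' τ) ∧ ∀ τ, (p r τ, p r (τ + 1)) ≠ (p r' (τ + 1), p r' τ)

/-- At most one agent moves in each time step. -/
def Sequential (p : R → ℕ → V) : Prop :=
  ∀ τ r r', p r τ ≠ p r (τ + 1) → p r' τ ≠ p r' (τ + 1) → r = r'

/-- The number of edges of the path of a trajectory, i.e. of the trajectory with consecutive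
repetitions removed: the number of time steps in which the agent changes its vertex
(finitely many for a feasible trajectory). -/
noncomputable def pathLength (p : ℕ → V) : ℕ :=
  Set.ncard {τ : ℕ | p τ ≠ p (τ + 1)}

/-- The distance cost of a motion plan. -/
noncomputable def cost [Fintype R] (p : R → ℕ → V) : ℕ :=
  ∑ r, pathLength (p r)

/-- The cost `d*(M)` at which every agent takes a shortest path. -/
noncomputable def dStar [Fintype R] (M : MAPF V R) : ℕ :=
  ∑ r, M.graph.dist (M.src r) (M.trg r)

end MAPF

/-! ### 3-SAT -/

/-- A 3-CNF formula with variables `Fin N` and clauses `Fin m`: the `k`-th literal of clause `j` is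
`φ j k`, where `(v, true)` is the positive and `(v, false)` the negative literal of `v`. -/
abbrev CNF3 (N m : ℕ) := Fin m → Fin 3 → Fin N × Bool

namespace CNF3

variable {N m : ℕ}

def Satisfiable (φ : CNF3 N m) : Prop :=
  ∃ A : Fin N → Bool, ∀ j, ∃ k, A (φ j k).1 = (φ j k).2

/-- The number of appearances of a literal. -/
def occ (φ : CNF3 N m) (l : Fin N × Bool) : ℕ :=
  Fintype.card {o : Fin m × Fin 3 // φ o.1 o.2 = l}

/-- The number of columns reserved for start positions in the gadget of the variable `v`. -/
def slots (φ : CNF3 N m) (v : Fin N) : ℕ :=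
  max (φ.occ (v, true)) (φ.occ (v, false))

end CNF3

/-! ### The construction -/

/-- The arbitrary choices of the construction: the order of the variable gadgets, the order of the
clause gadgets, the order of the start positions on each path of a variable gadget, the order of the
literals' targets in each clause gadget, and the places of the clause agents in their room. -/
structure Layout {N m : ℕ} (φ : CNF3 N m) where
  varPos : Equiv.Perm (Fin N)
  clausePos : Equiv.Perm (Fin m)
  slot : Fin m → Fin 3 → ℕ
  slot_lt : ∀ j k, slot j k < φ.slots (φ j k).1
  slot_inj : ∀ j k j' k', φ j k = φ j' k' → slot j k = slot j' k' → j = j' ∧ k = k'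
  litPos : Fin m → Equiv.Perm (Fin 3)
  room : Fin m ↪ Fin ((m - 1) / 3 + 1) × Fin 3

/-- The agents: one per clause, one per appearance of a literal, one blocker per variable. -/
inductive Agent (N m : ℕ) where
  | clause (j : Fin m)
  | literal (j : Fin m) (k : Fin 3)
  | blocker (v : Fin N)
  deriving DecidableEq, Fintype

/-- The grid on `ℕ × ℕ`: cells (column, row) that share a side are adjacent. -/
def gridGraph : SimpleGraph (ℕ × ℕ) where
  Adj a b := (a.1 = b.1 ∧ (a.2 + 1 = b.2 ∨ b.2 + 1 = a.2)) ∨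
    (a.2 = b.2 ∧ (a.1 + 1 = b.1 ∨ b.1 + 1 = a.1))
  symm := ⟨fun a b h => by omega⟩
  loopless := ⟨fun a h => by omega⟩

/-- The free cells of a variable gadget with `s` slots, relative to its left end; row `0` is the
bottom row, row `2` the top row. With a dot for a free cell and a hash for an obstacle (`s = 2`):
```
. . . . . . . #
. # . # # # . #
. # . . . . . .
```
Column `0` lets agents go up to the top row; the top cell of column `1` is the entrance; the bottom
cell of column `s + 5` is the exit. The top path runs right along the top row and then down column
`s + 4`, the bottom path runs down column `2` and then right along the bottom row. Columns
`4, …, s + 3` hold the start positions, column `3` is left empty. -/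
def varShape (s x y : ℕ) : Prop :=
  y < 3 ∧ (x = 0 ∨ (x = 1 ∧ y = 2) ∨ x = 2 ∨ (3 ≤ x ∧ x ≤ s + 3 ∧ y ≠ 1) ∨ x = s + 4 ∨
    (x = s + 5 ∧ y = 0))

/-- The free cells of a clause gadget, relative to its left end:
```
. . . . . . #
. # . # . . #
. . . . . . .
```
The middle cells of columns `0, 2, 4` are the literals' targets, the top cell of column `4` is the
clause agent's target, column `5` is the empty column. -/
def clauseShape (x y : ℕ) : Prop :=
  y < 3 ∧ (x = 0 ∨ (x = 1 ∧ y ≠ 1) ∨ x = 2 ∨ (x = 3 ∧ y ≠ 1) ∨ x = 4 ∨ x = 5 ∨ (x = 6 ∧ y = 0))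

namespace Layout

variable {N m : ℕ} {φ : CNF3 N m}

/-- The column of the left end of the gadget of the variable `v`. For the leftmost gadget this is
the last column of the clause agents' room, which consists of the columns `0, …, (m - 1) / 3`. -/
def varCol (L : Layout φ) (v : Fin N) : ℕ :=
  (m - 1) / 3 + ∑ u with L.varPos u < L.varPos v, (φ.slots u + 6)

/-- The column of the left end of the gadget of the clause `j`. -/
def clauseCol (L : Layout φ) (j : Fin m) : ℕ :=
  (m - 1) / 3 + ∑ u, (φ.slots u + 6) + 7 * (L.clausePos j : ℕ)

/-- The cells that are not obstacles. -/
def Free (L : Layout φ) : Set (ℕ × ℕ) :=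
  {c | (c.1 ≤ (m - 1) / 3 ∧ c.2 < 3) ∨
    (∃ v x, c.1 = L.varCol v + x ∧ varShape (φ.slots v) x c.2) ∨
    (∃ j x, c.1 = L.clauseCol j + x ∧ clauseShape x c.2)}

/-- Start cells. Blockers start at the entrance of their gadget; positive literal agents on the top
path and negative ones on the bottom path of their variable's gadget. -/
def start (L : Layout φ) : Agent N m → ℕ × ℕ
  | .clause j => ((L.room j).1, (L.room j).2)
  | .literal j k => (L.varCol (φ j k).1 + (4 + L.slot j k), if (φ j k).2 then 2 else 0)
  | .blocker v => (L.varCol v + 1, 2)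

/-- Target cells. Blockers go to the exit of their gadget. -/
def target (L : Layout φ) : Agent N m → ℕ × ℕ
  | .clause j => (L.clauseCol j + 4, 2)
  | .literal j k => (L.clauseCol j + 2 * (L.litPos j k : ℕ), 1)
  | .blocker v => (L.varCol v + (φ.slots v + 5), 0)

theorem start_free (L : Layout φ) (r : Agent N m) : L.start r ∈ L.Free := by
  cases r with
  | clause j =>
    left
    simp only [start]
    have := (L.room j).1.2
    have := (L.room j).2.2
    omega
  | literal j k =>
    right; left
    refine ⟨(φ j k).1, 4 + L.slot j k, rfl, ?_⟩
    have := L.slot_lt j k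
    simp only [start, varShape]
    split_ifs <;> simp <;> omega
  | blocker v =>
    right; left
    refine ⟨v, 1, rfl, ?_⟩
    simp [start, varShape]

theorem target_free (L : Layout φ) (r : Agent N m) : L.target r ∈ L.Free := by
  cases r with
  | clause j =>
    right; right
    refine ⟨j, 4, rfl, ?_⟩
    simp [target, clauseShape]
  | literal j k =>
    right; right
    refine ⟨j, 2 * (L.litPos j k : ℕ), rfl, ?_⟩
    have := (L.litPos j k).2
    simp only [target, clauseShape]
    omega
  | blocker v =>
    right; left
    refine ⟨v, φ.slots v + 5, rfl, ?_⟩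
    simp [target, varShape]

/-- The instance `M'`: the grid graph on the free cells, with the agents above. -/
def inst (L : Layout φ) : MAPF L.Free (Agent N m) where
  graph := gridGraph.induce L.Free
  src r := ⟨L.start r, L.start_free r⟩
  trg r := ⟨L.target r, L.target_free r⟩

/-- The choices can always be made. -/
theorem exists_layout (φ : CNF3 N m) : Nonempty (Layout φ) := by
  classical
  have hroom : Fintype.card (Fin m) ≤ Fintype.card (Fin ((m - 1) / 3 + 1) × Fin 3) := by
    simp only [Fintype.card_prod, Fintype.card_fin]
    omega
  obtain ⟨e⟩ := Function.Embedding.nonempty_of_card_le hroom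
  let f : ∀ l : Fin N × Bool, {o : Fin m × Fin 3 // φ o.1 o.2 = l} ≃ Fin (φ.occ l) :=
    fun l => Fintype.equivFin _
  refine ⟨⟨1, 1, fun j k => (f (φ j k) ⟨(j, k), rfl⟩ : ℕ), ?_, ?_, fun _ => 1, e⟩⟩
  · intro j k
    refine lt_of_lt_of_le (f (φ j k) ⟨(j, k), rfl⟩).2 ?_
    obtain ⟨v, b⟩ := φ j k
    cases b
    · exact le_max_right _ _
    · exact le_max_left _ _
  · intro j k j' k' h hs
    have key : ∀ l (h1 : φ j k = l) (h2 : φ j' k' = l),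
        (f l ⟨(j, k), h1⟩ : ℕ) = f l ⟨(j', k'), h2⟩ → j = j' ∧ k = k' := by
      intro l h1 h2 h3
      have := (f l).injective (Fin.ext h3)
      simpa using this
    have hcast : ∀ l (h1 : φ j k = l),
        (f l ⟨(j, k), h1⟩ : ℕ) = f (φ j k) ⟨(j, k), rfl⟩ := by
      intro l h1
      subst h1
      rfl
    exact key (φ j' k') h rfl ((hcast _ h).trans hs)

end Layout

/-! The level `Layout.height` is a potential that changes by exactly one along every edge: column
plus row outside the variable gadgets, column minus row inside them, shifted by 4 for every gadget
begun. Every agent can climb from its start to its target (`dist_eq`), so a plan of cost `dStar` is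
one in which every move raises the level (`IsMotionPlan.climbs`). Climbing agents never go left, and
one that overtakes another shares a level with it at some time (`Climbs.exists_eq`); without a
collision this needs two cells of equal level.

From a plan to an assignment: inside a variable gadget two cells share a level only where the top
and the bottom way are separate, and a climbing agent uses just one of the two ways. Hence an agent
that crosses the gadget from the left takes the way that the blocker does not take (`crosses`). Let
a variable be true if its blocker takes the top way. A clause agent has to pass through the target
of one of its literal agents (`exists_passes`) and starts below that agent, so the two share a level
on the way. This is impossible in column 0 of a gadget, in the clause gadgets, and in later variable
gadgets, where both avoid the way of the same blocker. It happens in the literal's own gadget, and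
the literal agent is on the blocker's way there: the literal is true (`satisfiable_of_plan`).

From an assignment to a plan: each blocker steps aside onto the way of its true literal, behind the
literal agents waiting there. Then the agents of false literals leave, then the clause agents, each
through the target of a true literal of its clause, then the agents of true literals, then the
blockers. Everybody climbs along a lane that is free of the others (`reflTransGen_of_lanes`,
`cleared_not_mem_lane`, `target_not_mem_lane`). -/

namespace MAPF

variable {V R : Type}

/-! ### Potentials and trajectories that climb. -/

theorem pathLength_eq_sum [DecidableEq V] {q : ℕ → V} {t : V} {T : ℕ} (hT : ∀ τ, T ≤ τ → q τ = t) :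
    (pathLength q : ℤ) = ∑ τ ∈ Finset.range T, if q τ = q (τ + 1) then 0 else 1 := by
  have : {τ : ℕ | q τ ≠ q (τ + 1)} = ((Finset.range T).filter fun τ => ¬ q τ = q (τ + 1) :) := by
    ext τ
    simp only [Set.mem_ofPred_eq, Finset.coe_filter, Finset.mem_range]
    refine ⟨fun h => ⟨?_, h⟩, fun h => h.2⟩
    by_contra hτ
    exact h ((hT τ (by omega)).trans (hT (τ + 1) (by omega)).symm)
  rw [pathLength, this, Set.ncard_coe_finset, Finset.card_filter]
  push_cast
  exact Finset.sum_congr rfl fun τ _ => by split_ifs <;> simp_all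

/-- A trajectory along which every move raises `h` by one. -/
def Climbs (h : V → ℤ) (q : ℕ → V) : Prop :=
  ∀ τ, q τ = q (τ + 1) ∨ h (q (τ + 1)) = h (q τ) + 1

theorem Climbs.pathLength_eq {h : V → ℤ} {q : ℕ → V} (hq : Climbs h q) {t : V} {T : ℕ}
    (hT : ∀ τ, T ≤ τ → q τ = t) : (pathLength q : ℤ) = h t - h (q 0) := by
  classical
  rw [pathLength_eq_sum hT, ← hT T le_rfl, ← Finset.sum_range_sub (fun τ => h (q τ))]
  refine Finset.sum_congr rfl fun τ _ => ?_
  split_ifs with e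
  · rw [← e, sub_self]
  · rcases hq τ with h1 | h1
    · exact absurd h1 e
    · omega

/-- If `h` changes by at most one along edges, then a trajectory takes at least `h t - h s` moves,
and if it takes no more, then each of them raises `h`. -/
theorem IsTrajectory.le_pathLength {G : SimpleGraph V} {h : V → ℤ}
    (hG : ∀ a b, G.Adj a b → h b ≤ h a + 1) {s t : V} {q : ℕ → V} (hq : IsTrajectory G s t q) :
    h t - h s ≤ pathLength q ∧ ((pathLength q : ℤ) = h t - h s → Climbs h q) := by
  classical
  obtain ⟨rfl, ⟨T, hT⟩, hadj⟩ := hq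
  have hle : ∀ τ ∈ Finset.range T,
      h (q (τ + 1)) - h (q τ) ≤ if q τ = q (τ + 1) then 0 else 1 := by
    intro τ _
    split_ifs with e
    · rw [← e, sub_self]
    · have := hG _ _ ((hadj τ).resolve_left e)
      omega
  have htel : h t - h (q 0) = ∑ τ ∈ Finset.range T, (h (q (τ + 1)) - h (q τ)) := by
    rw [Finset.sum_range_sub (fun τ => h (q τ)), hT T le_rfl]
  rw [pathLength_eq_sum hT, htel]
  refine ⟨Finset.sum_le_sum hle, fun heq τ => ?_⟩
  by_cases hτ : τ < T
  · have := (Finset.sum_eq_sum_iff_of_le hle).1 heq.symm τ (Finset.mem_range.2 hτ)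
    split_ifs at this with e
    · exact Or.inl e
    · right; omega
  · left
    rw [hT τ (by omega), hT (τ + 1) (by omega)]

theorem height_sub_le_length {G : SimpleGraph V} {h : V → ℤ}
    (hG : ∀ a b, G.Adj a b → h b ≤ h a + 1) {s t : V} (w : G.Walk s t) : h t - h s ≤ w.length := by
  induction w with
  | nil => simp
  | cons e w ih =>
    have := hG _ _ e
    rw [SimpleGraph.Walk.length_cons]
    push_cast
    omega

/-- A set of vertices in which one gets from anywhere to `g` by moves that raise `h` by one. -/
structure IsLane (G : SimpleGraph V) (h : V → ℤ) (P : Set V) (g : V) : Prop where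
  ascend : ∀ c ∈ P, c ≠ g → ∃ c' ∈ P, G.Adj c c' ∧ h c' = h c + 1
  le : ∀ c ∈ P, h c ≤ h g

theorem IsLane.exists_walk {G : SimpleGraph V} {h : V → ℤ} {P : Set V} {g : V}
    (hP : IsLane G h P g) (c : V) (hc : c ∈ P) : ∃ w : G.Walk c g, (w.length : ℤ) = h g - h c := by
  induction hn : (h g - h c).toNat generalizing c with
  | zero =>
    by_cases e : c = g
    · subst e
      exact ⟨.nil, by simp⟩
    · obtain ⟨c', hc', -, h2⟩ := hP.ascend c hc e
      have := hP.le c' hc'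
      omega
  | succ n ih =>
    have e : c ≠ g := by
      rintro rfl
      simp at hn
    obtain ⟨c', hc', h1, h2⟩ := hP.ascend c hc e
    obtain ⟨w, hw⟩ := ih c' hc' (by omega)
    refine ⟨.cons h1 w, ?_⟩
    rw [SimpleGraph.Walk.length_cons]
    push_cast
    omega

/-- The lane gives a walk of this length, and the potential forbids a shorter one. -/
theorem IsLane.dist_eq {G : SimpleGraph V} {h : V → ℤ} (hG : ∀ a b, G.Adj a b → h b ≤ h a + 1)
    {P : Set V} {g : V} (hP : IsLane G h P g) {c : V} (hc : c ∈ P) :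
    (G.dist c g : ℤ) = h g - h c := by
  obtain ⟨w, hw⟩ := hP.exists_walk c hc
  obtain ⟨w', hw'⟩ := w.reachable.exists_walk_length_eq_dist
  have h1 := height_sub_le_length hG w'
  have h2 := SimpleGraph.dist_le w
  omega

/-- In a motion plan of minimum cost every move raises `h`. -/
theorem IsMotionPlan.climbs [Fintype R] {M : MAPF V R} {h : V → ℤ}
    (hG : ∀ a b, M.graph.Adj a b → h b ≤ h a + 1)
    (hdist : ∀ r, (M.graph.dist (M.src r) (M.trg r) : ℤ) = h (M.trg r) - h (M.src r))
    {p : R → ℕ → V} (hp : M.IsMotionPlan p) (hcost : cost p = M.dStar) (r : R) :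
    Climbs h (p r) := by
  have hle : ∀ r ∈ Finset.univ, M.graph.dist (M.src r) (M.trg r) ≤ pathLength (p r) := by
    intro r _
    have := ((hp r).le_pathLength hG).1
    rw [← hdist r] at this
    exact_mod_cast this
  -- No agent is below its distance, so equality of the sums forces equality for each agent.
  have := (Finset.sum_eq_sum_iff_of_le hle).1 hcost.symm r (Finset.mem_univ r)
  refine ((hp r).le_pathLength hG).2 ?_
  rw [← hdist r, this]

theorem Climbs.monotone {h : V → ℤ} {q : ℕ → V} (hq : Climbs h q) :
    Monotone fun τ => h (q τ) := by
  refine monotone_nat_of_le_succ fun τ => ?_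
  rcases hq τ with e | e
  · rw [← e]
  · omega

/-- An agent that overtakes another one is at some time on the same level. -/
theorem Climbs.exists_eq {h : V → ℤ} {a b : ℕ → V} (ha : Climbs h a) (hb : Climbs h b)
    {t : ℕ} (h0 : h (a 0) ≤ h (b 0)) (ht : h (b t) ≤ h (a t)) :
    ∃ τ ≤ t, h (a τ) = h (b τ) := by
  induction t with
  | zero => exact ⟨0, le_rfl, le_antisymm h0 ht⟩
  | succ t ih =>
    by_cases h1 : h (b t) ≤ h (a t)
    · obtain ⟨τ, h2, h3⟩ := ih h1
      exact ⟨τ, by omega, h3⟩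
    -- At time `t` the agent `a` is strictly below `b`, and it gains at most one level in a step, so
    -- it can only draw level.
    · refine ⟨t + 1, le_rfl, ?_⟩
      have h2 : h (b t) ≤ h (b (t + 1)) := hb.monotone (Nat.le_succ t)
      rcases ha t with e | e
      · rw [← e] at ht ⊢
        omega
      · omega

/-! ### Sequential plans from lanes. -/

/-- One agent makes a move that raises `h` to an unoccupied vertex. -/
def Step [DecidableEq R] (G : SimpleGraph V) (h : V → ℤ) (q q' : R → V) : Prop :=
  ∃ r v, G.Adj (q r) v ∧ h v = h (q r) + 1 ∧ (∀ r', q r' ≠ v) ∧ q' = Function.update q r v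

theorem Step.injective [DecidableEq R] {G : SimpleGraph V} {h : V → ℤ} {q q' : R → V}
    (hs : Step G h q q') (hq : Function.Injective q) : Function.Injective q' := by
  obtain ⟨r, v, -, -, h3, rfl⟩ := hs
  intro a b hab
  by_cases ha : a = r <;> by_cases hb : b = r
  · rw [ha, hb]
  · subst ha
    rw [Function.update_self, Function.update_of_ne hb] at hab
    exact absurd hab.symm (h3 b)
  · subst hb
    rw [Function.update_self, Function.update_of_ne ha] at hab
    exact absurd hab (h3 a)
  · rw [Function.update_of_ne ha, Function.update_of_ne hb] at hab
    exact hq hab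

open Relation

theorem IsLane.reflTransGen [DecidableEq R] {G : SimpleGraph V} {h : V → ℤ} {P : Set V} {g : V}
    (hP : IsLane G h P g) (q : R → V) (r : R) (hr : q r ∈ P) (hother : ∀ r', r' ≠ r → q r' ∉ P) :
    ReflTransGen (Step G h) q (Function.update q r g) := by
  induction hn : (h g - h (q r)).toNat generalizing q with
  | zero =>
    by_cases e : q r = g
    · subst e
      rw [Function.update_eq_self]
    · obtain ⟨c', hc', -, h2⟩ := hP.ascend _ hr e
      have := hP.le c' hc'
      omega
  | succ n ih =>
    have e : q r ≠ g := by
      intro e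
      rw [e] at hn
      simp at hn
    obtain ⟨c', hc', h1, h2⟩ := hP.ascend _ hr e
    have hs : Step G h q (Function.update q r c') := by
      refine ⟨r, c', h1, h2, fun r' e' => ?_, rfl⟩
      by_cases hr' : r' = r
      · rw [hr'] at e'
        exact h1.ne e'
      · exact hother r' hr' (e' ▸ hc')
    have := ih (Function.update q r c') (by simpa using hc')
      (fun r' hr' => by simpa [Function.update_of_ne hr'] using hother r' hr')
      (by rw [Function.update_self]; omega)
    rw [Function.update_idem] at this
    exact .head hs this

/-- The agents go one after the other, in the order of the keys, each along its own lane. -/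
theorem reflTransGen_of_lanes [DecidableEq R] [Fintype R] {α : Type} [LinearOrder α]
    {G : SimpleGraph V} {h : V → ℤ} (key : R → α) (lane : R → Set V) (s t : R → V)
    (hlane : ∀ r, IsLane G h (lane r) (t r)) (hs : ∀ r, s r ∈ lane r)
    (hbefore : ∀ r r', r' ≠ r → key r' ≤ key r → t r' ∉ lane r)
    (hafter : ∀ r r', r' ≠ r → key r ≤ key r' → s r' ∉ lane r) :
    ReflTransGen (Step G h) s t := by
  have main : ∀ S : Finset R, (∀ r ∈ S, ∀ r' ∉ S, key r' ≤ key r) →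
      ReflTransGen (Step G h) (fun r => if r ∈ S then s r else t r) t := by
    intro S
    induction S using Finset.induction_on_min_value key with
    | empty =>
      intro _
      simpa using ReflTransGen.refl
    | insert a S ha hmin ih =>
      intro hS
      refine ReflTransGen.trans ?_ (ih fun r hr r' hr' => ?_)
      · have := (hlane a).reflTransGen (fun r => if r ∈ insert a S then s r else t r) a
          (by simpa using hs a) ?_
        · convert this using 1
          ext1 r
          by_cases hra : r = a
          · subst hra
            simp [ha]
          · simp [hra]
        · intro r' hr'
          by_cases hr'S : r' ∈ S
          · simpa [hr'S] using hafter a r' hr' (hmin r' hr'S)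
          · simpa [hr'S, hr'] using hbefore a r' hr'
              (hS a (Finset.mem_insert_self _ _) r' (by simp [hr', hr'S]))
      · by_cases e : r' = a
        · rw [e]
          exact hmin r hr
        · exact hS r (Finset.mem_insert_of_mem hr) r' (by simp [e, hr'])
  simpa using main Finset.univ (by simp)

theorem exists_config_sequence [DecidableEq R] {G : SimpleGraph V} {h : V → ℤ} {s t : R → V}
    (hst : ReflTransGen (Step G h) s t) :
    ∃ c : ℕ → R → V, c 0 = s ∧ (∃ T, ∀ τ, T ≤ τ → c τ = t) ∧
      ∀ τ, c τ = c (τ + 1) ∨ Step G h (c τ) (c (τ + 1)) := by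
  induction hst using ReflTransGen.head_induction_on with
  | refl => exact ⟨fun _ => t, rfl, ⟨0, fun _ _ => rfl⟩, fun _ => .inl rfl⟩
  | @head a b hab _ ih =>
    obtain ⟨c, h0, ⟨T, hT⟩, hc⟩ := ih
    refine ⟨fun τ => Nat.casesOn τ a c, rfl, ⟨T + 1, ?_⟩, ?_⟩
    · rintro (_ | τ) hτ
      · omega
      · exact hT τ (by omega)
    · rintro (_ | τ)
      · right
        simpa [h0] using hab
      · exact hc τ

theorem exists_sequential_plan [DecidableEq R] (M : MAPF V R) {h : V → ℤ}
    (hinj : Function.Injective M.src) (hst : ReflTransGen (Step M.graph h) M.src M.trg) :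
    ∃ p, M.IsMotionPlan p ∧ CollisionFree p ∧ Sequential p ∧
      ∀ r, (pathLength (p r) : ℤ) = h (M.trg r) - h (M.src r) := by
  obtain ⟨c, h0, ⟨T, hT⟩, hc⟩ := exists_config_sequence hst
  have hcinj : ∀ τ, Function.Injective (c τ) := by
    intro τ
    induction τ with
    | zero => rwa [h0]
    | succ τ ih =>
      rcases hc τ with e | e
      · rwa [← e]
      · exact e.injective ih
  have hseq : ∀ τ r r', c τ r ≠ c (τ + 1) r → c τ r' ≠ c (τ + 1) r' → r = r' := by
    intro τ r r' hr hr'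
    rcases hc τ with e | ⟨a, v, -, -, -, h4⟩
    · exact absurd (congrFun e r) hr
    · have key : ∀ b, c τ b ≠ c (τ + 1) b → b = a := by
        intro b hb
        by_contra hba
        rw [h4, Function.update_of_ne hba] at hb
        exact hb rfl
      rw [key r hr, key r' hr']
  have hclimb : ∀ r, Climbs h fun τ => c τ r := by
    intro r τ
    rcases hc τ with e | ⟨r', v, -, h2, -, h4⟩
    · exact .inl (congrFun e r)
    · by_cases hr : r = r'
      · subst hr
        right
        simp only [h4, Function.update_self, h2]
      · left
        simp only [h4, Function.update_of_ne hr]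
  refine ⟨fun r τ => c τ r, fun r => ⟨congrFun h0 r, ⟨T, fun τ hτ => congrFun (hT τ hτ) r⟩, fun τ => ?_⟩,
    fun r r' hrr' => ⟨fun τ e => hrr' (hcinj τ e), fun τ e => ?_⟩, hseq, fun r => ?_⟩
  · rcases hc τ with e | ⟨a, v, h1, -, -, h4⟩
    · exact .inl (congrFun e r)
    · by_cases hr : r = a
      · subst hr
        right
        simpa only [h4, Function.update_self] using h1
      · left
        simp only [h4, Function.update_of_ne hr]
  -- In a swap both agents would move at once; if one of them rests, the two coincide at time `τ +
  -- 1`.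
  · obtain ⟨e1, e2⟩ := Prod.mk.inj e
    by_cases hr : c τ r = c (τ + 1) r
    · exact hrr' (hcinj (τ + 1) (hr.symm.trans e1))
    · refine hrr' (hseq τ r r' hr fun hr' => hrr' (hcinj (τ + 1) (hr' ▸ e2 : _)))
  · rw [(hclimb r).pathLength_eq fun τ hτ => congrFun (hT τ hτ) r, h0]

end MAPF

namespace Layout

variable {N m : ℕ} {φ : CNF3 N m}

/-! ### Columns of the gadgets. -/

/-- The first column of the clause gadgets. -/
def zone (φ : CNF3 N m) : ℕ := (m - 1) / 3 + ∑ u, (φ.slots u + 6)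

theorem clauseCol_eq (L : Layout φ) (j : Fin m) : L.clauseCol j = zone φ + 7 * (L.clausePos j : ℕ) :=
  rfl

theorem varCol_add_le (L : Layout φ) {u v : Fin N} (h : L.varPos u < L.varPos v) :
    L.varCol u + φ.slots u + 6 ≤ L.varCol v := by
  have : ∑ w with L.varPos w < L.varPos u, (φ.slots w + 6) + (φ.slots u + 6) ≤
      ∑ w with L.varPos w < L.varPos v, (φ.slots w + 6) := by
    rw [add_comm, ← Finset.sum_insert (f := fun w => φ.slots w + 6) (by simp)]
    refine Finset.sum_le_sum_of_subset fun w hw => ?_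
    simp only [Finset.mem_insert, Finset.mem_filter, Finset.mem_univ, true_and] at hw ⊢
    rcases hw with rfl | hw
    · exact h
    · exact hw.trans h
  simp only [varCol]
  omega

theorem varCol_add_le_zone (L : Layout φ) (v : Fin N) : L.varCol v + φ.slots v + 6 ≤ zone φ := by
  have : ∑ w with L.varPos w < L.varPos v, (φ.slots w + 6) + (φ.slots v + 6) ≤
      ∑ w, (φ.slots w + 6) := by
    rw [add_comm, ← Finset.sum_insert (f := fun w => φ.slots w + 6) (by simp)]
    exact Finset.sum_le_sum_of_subset (Finset.subset_univ _)
  simp only [varCol, zone]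
  omega

theorem le_varCol (L : Layout φ) (v : Fin N) : (m - 1) / 3 ≤ L.varCol v := Nat.le_add_right _ _

/-- The order of the gadgets in the linear form that `omega` can use. -/
theorem varCol_trichotomy (L : Layout φ) (u v : Fin N) :
    u = v ∨ ((L.varPos u : ℕ) < L.varPos v ∧ L.varCol u + φ.slots u + 6 ≤ L.varCol v) ∨
      ((L.varPos v : ℕ) < L.varPos u ∧ L.varCol v + φ.slots v + 6 ≤ L.varCol u) := by
  rcases lt_trichotomy (L.varPos u) (L.varPos v) with h | h | h
  · exact .inr (.inl ⟨h, L.varCol_add_le h⟩)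
  · exact .inl (L.varPos.injective h)
  · exact .inr (.inr ⟨h, L.varCol_add_le h⟩)

theorem varCol_succ (L : Layout φ) (v : Fin N) :
    (∃ w, L.varCol v + φ.slots v + 6 = L.varCol w ∧ (L.varPos w : ℕ) = L.varPos v + 1) ∨
      (L.varCol v + φ.slots v + 6 = zone φ ∧ (L.varPos v : ℕ) + 1 = N) := by
  -- The gadget of `v` and those before it form an initial segment; its total width gives the column
  -- where the next gadget, or the clause zone, begins.
  have hins : ∀ S : Finset (Fin N), (∀ w, w ∈ S ↔ w = v ∨ L.varPos w < L.varPos v) →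
      L.varCol v + φ.slots v + 6 = (m - 1) / 3 + ∑ w ∈ S, (φ.slots w + 6) := by
    intro S hS
    have : S = insert v (Finset.univ.filter fun w => L.varPos w < L.varPos v) := by
      ext w
      simp [hS]
    rw [this, Finset.sum_insert (by simp), varCol]
    omega
  have hlt : ∀ w, w = v ∨ L.varPos w < L.varPos v ↔ (L.varPos w : ℕ) < L.varPos v + 1 := by
    intro w
    rw [← L.varPos.injective.eq_iff, Fin.ext_iff, Fin.lt_def]
    omega
  by_cases h : (L.varPos v : ℕ) + 1 < N
  · left
    refine ⟨L.varPos.symm ⟨L.varPos v + 1, h⟩, ?_, by simp⟩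
    refine hins _ fun w => ?_
    simp only [Finset.mem_filter, Finset.mem_univ, true_and, hlt]
    rw [Fin.lt_def]
    simp
  · right
    refine ⟨hins _ fun w => ?_, by omega⟩
    simp only [Finset.mem_univ, hlt, true_iff]
    omega

theorem varCol_first (L : Layout φ) (hN : 0 < N) :
    ∃ v, L.varCol v = (m - 1) / 3 ∧ (L.varPos v : ℕ) = 0 := by
  refine ⟨L.varPos.symm ⟨0, hN⟩, ?_, by simp⟩
  have : (Finset.univ.filter fun u => L.varPos u < L.varPos (L.varPos.symm ⟨0, hN⟩)) = ∅ := by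
    ext w
    rw [Finset.mem_filter, Fin.lt_def]
    simp
  rw [varCol, this, Finset.sum_empty, add_zero]

/-! ### The level function. -/

/-- The number of variable gadgets that begin to the left of the column `x`. -/
def gadgetsBefore (L : Layout φ) (x : ℕ) : ℕ := (Finset.univ.filter fun v => L.varCol v < x).card

/-- The column is one of a variable gadget, but not its column `0`. -/
def Inner (L : Layout φ) (x : ℕ) : Prop := ∃ v, L.varCol v < x ∧ x ≤ L.varCol v + φ.slots v + 5

open Classical in
/-- The level of a cell: the moves of a shortest plan are those that raise it by one. -/
noncomputable def height (L : Layout φ) (c : ℕ × ℕ) : ℤ :=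
  if L.Inner c.1 then c.1 - c.2 + 4 * L.gadgetsBefore c.1 else c.1 + c.2 + 4 * L.gadgetsBefore c.1

theorem gadgetsBefore_eq (L : Layout φ) {x k : ℕ} (hk : k ≤ N)
    (h : ∀ v, L.varCol v < x ↔ (L.varPos v : ℕ) < k) : L.gadgetsBefore x = k := by
  have : (Finset.univ.filter fun v => L.varCol v < x) =
      (Finset.univ.filter fun i : Fin N => (i : ℕ) < k).map L.varPos.symm.toEmbedding := by
    ext v
    simp [h]
  rw [gadgetsBefore, this, Finset.card_map, Fin.card_filter_val_lt, min_eq_right hk]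

theorem height_room (L : Layout φ) {c : ℕ × ℕ} (hc : c.1 ≤ (m - 1) / 3) :
    L.height c = c.1 + c.2 := by
  have h1 : ¬ L.Inner c.1 := by
    rintro ⟨v, h1, h2⟩
    have := L.le_varCol v
    omega
  have h2 : L.gadgetsBefore c.1 = 0 := L.gadgetsBefore_eq (Nat.zero_le _) fun v => by
    have := L.le_varCol v
    omega
  rw [height, if_neg h1, h2]
  simp

theorem height_varCol (L : Layout φ) {c : ℕ × ℕ} {v : Fin N} (hc : c.1 = L.varCol v) :
    L.height c = L.varCol v + c.2 + 4 * (L.varPos v : ℕ) := by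
  have h1 : ¬ L.Inner c.1 := by
    rintro ⟨w, h1, h2⟩
    rcases L.varCol_trichotomy v w with rfl | h | h <;> omega
  have h2 : L.gadgetsBefore c.1 = L.varPos v := L.gadgetsBefore_eq (L.varPos v).2.le fun w => by
    rcases L.varCol_trichotomy v w with rfl | h | h <;> omega
  rw [height, if_neg h1, h2, hc]

theorem height_inner (L : Layout φ) {c : ℕ × ℕ} {v : Fin N} (h1 : L.varCol v < c.1)
    (h2 : c.1 ≤ L.varCol v + φ.slots v + 5) :
    L.height c = c.1 - c.2 + 4 * (L.varPos v : ℕ) + 4 := by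
  have h3 : L.gadgetsBefore c.1 = L.varPos v + 1 := L.gadgetsBefore_eq (L.varPos v).2 fun w => by
    rcases L.varCol_trichotomy v w with rfl | h | h <;> omega
  rw [height, if_pos ⟨v, h1, h2⟩, h3]
  push_cast
  ring

theorem height_zone (L : Layout φ) {c : ℕ × ℕ} (hc : zone φ ≤ c.1) :
    L.height c = c.1 + c.2 + 4 * N := by
  have h1 : ¬ L.Inner c.1 := by
    rintro ⟨w, h1, h2⟩
    have := L.varCol_add_le_zone w
    omega
  have h2 : L.gadgetsBefore c.1 = N := L.gadgetsBefore_eq le_rfl fun w => by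
    have := L.varCol_add_le_zone w
    have := (L.varPos w).2
    omega
  rw [height, if_neg h1, h2]

theorem clauseCol_trichotomy (L : Layout φ) (i j : Fin m) :
    i = j ∨ L.clauseCol i + 7 ≤ L.clauseCol j ∨ L.clauseCol j + 7 ≤ L.clauseCol i := by
  simp only [clauseCol_eq]
  rcases lt_trichotomy (L.clausePos i) (L.clausePos j) with h | h | h
  · right; left
    rw [Fin.lt_def] at h
    omega
  · exact .inl (L.clausePos.injective h)
  · right; right
    rw [Fin.lt_def] at h
    omega

theorem zone_le_clauseCol (L : Layout φ) (j : Fin m) : zone φ ≤ L.clauseCol j := by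
  rw [clauseCol_eq]
  omega

/-- The free cells: those of the room without its last column, of the variable gadgets,
and of the clause gadgets, with their levels. -/
theorem free_cases (L : Layout φ) {c : ℕ × ℕ} (hc : c ∈ L.Free) :
    (c.1 ≤ (m - 1) / 3 ∧ c.2 < 3 ∧ L.height c = c.1 + c.2) ∨
    (∃ v, c.1 = L.varCol v ∧ c.2 < 3 ∧ L.height c = L.varCol v + c.2 + 4 * (L.varPos v : ℕ)) ∨
    (∃ v, L.varCol v < c.1 ∧ c.1 ≤ L.varCol v + φ.slots v + 5 ∧
      varShape (φ.slots v) (c.1 - L.varCol v) c.2 ∧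
      L.height c = c.1 - c.2 + 4 * (L.varPos v : ℕ) + 4) ∨
    (∃ j, L.clauseCol j ≤ c.1 ∧ clauseShape (c.1 - L.clauseCol j) c.2 ∧
      L.height c = c.1 + c.2 + 4 * N) := by
  rcases hc with ⟨h1, h2⟩ | ⟨v, x, h1, h2⟩ | ⟨j, x, h1, h2⟩
  · exact .inl ⟨h1, h2, L.height_room h1⟩
  · right
    rcases Nat.eq_zero_or_pos x with rfl | hx
    · exact .inl ⟨v, h1, h2.1, L.height_varCol h1⟩
    · right; left
      have hx' : x ≤ φ.slots v + 5 := by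
        unfold varShape at h2
        omega
      refine ⟨v, by omega, by omega, ?_, L.height_inner (by omega) (by omega)⟩
      rwa [h1, Nat.add_sub_cancel_left]
  · right; right; right
    have := L.zone_le_clauseCol j
    refine ⟨j, by omega, ?_, L.height_zone (by omega)⟩
    rwa [h1, Nat.add_sub_cancel_left]

/-- The last column of the room is also column 0 of the leftmost gadget; every other gadget has at
least six columns between it and the room. -/
theorem varPos_eq_zero_or (L : Layout φ) (v : Fin N) :
    (L.varCol v = (m - 1) / 3 ∧ (L.varPos v : ℕ) = 0) ∨ (m - 1) / 3 + 6 ≤ L.varCol v := by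
  obtain ⟨w, h1, h2⟩ := L.varCol_first v.pos
  rcases L.varCol_trichotomy v w with rfl | h | h <;> omega

theorem varPos_eq_succ (L : Layout φ) {v w : Fin N}
    (h : L.varCol v + φ.slots v + 6 = L.varCol w) : (L.varPos w : ℕ) = L.varPos v + 1 := by
  rcases L.varCol_succ v with ⟨u, h1, h2⟩ | ⟨h1, h2⟩
  · rcases L.varCol_trichotomy u w with rfl | h | h <;> omega
  · have := L.varCol_add_le_zone w
    omega

theorem varPos_succ_eq (L : Layout φ) {v : Fin N}
    (h : L.varCol v + φ.slots v + 6 = zone φ) : (L.varPos v : ℕ) + 1 = N := by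
  rcases L.varCol_succ v with ⟨u, h1, h2⟩ | ⟨h1, h2⟩
  · have := L.varCol_add_le_zone u
    omega
  · exact h2

/-- A clause contains a variable, so there is at least one variable gadget, and it has at least six
columns. -/
theorem room_add_le_zone (φ : CNF3 N m) (j : Fin m) : (m - 1) / 3 + 6 ≤ zone φ := by
  have := Finset.single_le_sum (f := fun u => φ.slots u + 6) (fun _ _ => Nat.zero_le _)
    (Finset.mem_univ (φ j 0).1)
  simp only [zone]
  omega

/-- The sign of the row flips at the entrance, in the top row, where it costs 4; this is the shift
per gadget. It flips back behind the exit, in row 0, where the sign does not matter. -/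
theorem height_right (L : Layout φ) {a b : ℕ × ℕ} (ha : a ∈ L.Free) (hb : b ∈ L.Free)
    (hx : b.1 = a.1 + 1) (hy : b.2 = a.2) : L.height b = L.height a + 1 := by
  rcases L.free_cases ha with ⟨h1, h2, h3⟩ | ⟨v, h1, h2, h3⟩ | ⟨v, h1, h2, h4, h3⟩ |
    ⟨j, h1, h2, h3⟩ <;>
  rcases L.free_cases hb with ⟨k1, k2, k3⟩ | ⟨w, k1, k2, k3⟩ | ⟨w, k1, k2, k4, k3⟩ |
    ⟨i, k1, k2, k3⟩
  all_goals rw [h3, k3]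
  · omega
  · have := L.le_varCol w
    have := L.varPos_eq_zero_or w
    omega
  · have := L.le_varCol w
    have := L.varPos_eq_zero_or w
    unfold varShape at k4
    omega
  · have := L.zone_le_clauseCol i
    have := room_add_le_zone φ i
    omega
  · have := L.le_varCol v
    have := L.varPos_eq_zero_or v
    omega
  · rcases L.varCol_trichotomy v w with rfl | h | h <;> omega
  · unfold varShape at k4
    have := L.varPos_eq_succ (v := w) (w := v)
    rcases L.varCol_trichotomy v w with rfl | h | h <;> omega
  · have := L.zone_le_clauseCol i
    have := L.varCol_add_le_zone v
    have := (L.varPos v).2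
    omega
  · have := L.le_varCol v
    have := L.varPos_eq_zero_or v
    unfold varShape at h4
    omega
  · unfold varShape at h4
    have := L.varPos_eq_succ (v := v) (w := w)
    rcases L.varCol_trichotomy v w with rfl | h | h <;> omega
  · unfold varShape at h4 k4
    rcases L.varCol_trichotomy v w with rfl | h | h <;> omega
  · have := L.zone_le_clauseCol i
    have := L.varCol_add_le_zone v
    have := L.varPos_succ_eq (v := v)
    unfold varShape at h4
    omega
  · have := L.zone_le_clauseCol j
    have := room_add_le_zone φ j
    omega
  · have := L.zone_le_clauseCol j
    have := L.varCol_add_le_zone w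
    have := (L.varPos w).2
    omega
  · have := L.zone_le_clauseCol j
    have := L.varCol_add_le_zone w
    have := L.varPos_succ_eq (v := w)
    unfold varShape at k4
    omega
  · omega

theorem height_up_or_down (L : Layout φ) {a b : ℕ × ℕ} (hx : b.1 = a.1) :
    L.height b = L.height a + (b.2 - a.2) ∨ L.height b = L.height a - (b.2 - a.2) := by
  by_cases hI : L.Inner a.1
  · right
    rw [height, height, hx, if_pos hI, if_pos hI]
    ring
  · left
    rw [height, height, hx, if_neg hI, if_neg hI]
    ring

theorem height_le_of_adj (L : Layout φ) {a b : ℕ × ℕ} (ha : a ∈ L.Free) (hb : b ∈ L.Free)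
    (hab : gridGraph.Adj a b) : L.height b ≤ L.height a + 1 := by
  rcases hab with ⟨h1, h2⟩ | ⟨h1, h2 | h2⟩
  · rcases L.height_up_or_down h1.symm with h | h <;> omega
  · exact (L.height_right ha hb h2.symm h1.symm).le
  · have := L.height_right hb ha h2.symm h1
    omega

/-- The moves of a plan of minimum cost. -/
structure Ascends (L : Layout φ) (a b : ℕ × ℕ) : Prop where
  left : a ∈ L.Free
  right : b ∈ L.Free
  adj : gridGraph.Adj a b
  height_eq : L.height b = L.height a + 1

theorem Ascends.cases {L : Layout φ} {a b : ℕ × ℕ} (h : L.Ascends a b) :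
    (b.1 = a.1 + 1 ∧ b.2 = a.2) ∨ (b.1 = a.1 ∧ (b.2 = a.2 + 1 ∨ b.2 + 1 = a.2)) := by
  obtain ⟨ha, hb, hab, hh⟩ := h
  rcases hab with ⟨h1, h2⟩ | ⟨h1, h2 | h2⟩
  · omega
  · omega
  · have := L.height_right hb ha h2.symm h1
    omega

/-! ### The two ways through a variable gadget. -/

/-- The level of the bottom cell of column `0` of a variable gadget. -/
def varLevel (L : Layout φ) (v : Fin N) : ℤ := L.varCol v + 4 * (L.varPos v : ℕ)

/-- The cells between the two ways through a variable gadget that belong to the top one only. -/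
def OnTop (L : Layout φ) (u : Fin N) (c : ℕ × ℕ) : Prop :=
  L.varCol u + 3 ≤ c.1 ∧ c.1 ≤ L.varCol u + φ.slots u + 4 ∧
    (c.2 = 2 ∨ (c.1 = L.varCol u + φ.slots u + 4 ∧ c.2 = 1))

/-- The cells of a variable gadget that belong to the bottom way only. -/
def OnBottom (L : Layout φ) (u : Fin N) (c : ℕ × ℕ) : Prop :=
  L.varCol u + 2 ≤ c.1 ∧ c.1 ≤ L.varCol u + φ.slots u + 3 ∧
    (c.2 = 0 ∨ (c.1 = L.varCol u + 2 ∧ c.2 = 1))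

theorem OnTop.height_eq {L : Layout φ} {u : Fin N} {c : ℕ × ℕ} (h : L.OnTop u c) :
    L.height c = c.1 - c.2 + 4 * (L.varPos u : ℕ) + 4 := by
  unfold OnTop at h
  exact L.height_inner (v := u) (by omega) (by omega)

theorem OnBottom.height_eq {L : Layout φ} {u : Fin N} {c : ℕ × ℕ} (h : L.OnBottom u c) :
    L.height c = c.1 - c.2 + 4 * (L.varPos u : ℕ) + 4 := by
  unfold OnBottom at h
  exact L.height_inner (v := u) (by omega) (by omega)

/-- Everything up to column 0 of the gadget has level at most `varLevel u + 2`, and behind the exit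
the levels start at `varLevel u + slots + 10`. -/
theorem mem_gadget (L : Layout φ) {u : Fin N} {c : ℕ × ℕ} (hc : c ∈ L.Free)
    (h1 : L.varLevel u + 3 ≤ L.height c) (h2 : L.height c ≤ L.varLevel u + φ.slots u + 9) :
    L.varCol u < c.1 ∧ c.1 ≤ L.varCol u + φ.slots u + 5 ∧
      varShape (φ.slots u) (c.1 - L.varCol u) c.2 ∧
      L.height c = c.1 - c.2 + 4 * (L.varPos u : ℕ) + 4 := by
  unfold varLevel at h1 h2
  have := L.le_varCol u
  rcases L.free_cases hc with ⟨k1, k2, k3⟩ | ⟨w, k1, k2, k3⟩ | ⟨w, k1, k2, k4, k3⟩ |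
    ⟨i, k1, k2, k3⟩
  · omega
  · rcases L.varCol_trichotomy u w with rfl | h | h <;> omega
  · rcases L.varCol_trichotomy u w with rfl | h | h
    · exact ⟨k1, k2, k4, k3⟩
    · unfold varShape at k4
      omega
    · unfold varShape at k4
      omega
  · have := L.zone_le_clauseCol i
    have := L.varCol_add_le_zone u
    have := (L.varPos u).2
    omega

theorem onTop_or_onBottom (L : Layout φ) {u : Fin N} {a b : ℕ × ℕ} (ha : a ∈ L.Free)
    (hb : b ∈ L.Free) (hab : L.height a = L.height b) (h1 : L.varLevel u + 3 ≤ L.height a)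
    (h2 : L.height a ≤ L.varLevel u + φ.slots u + 9) (hne : a ≠ b) :
    (L.OnTop u a ∧ L.OnBottom u b) ∨ (L.OnBottom u a ∧ L.OnTop u b) := by
  obtain ⟨a1, a2, a3, a4⟩ := L.mem_gadget ha h1 h2
  obtain ⟨b1, b2, b3, b4⟩ := L.mem_gadget hb (hab ▸ h1) (hab ▸ h2)
  have hne' : ¬ (a.1 = b.1 ∧ a.2 = b.2) := fun h => hne (Prod.ext h.1 h.2)
  -- Besides the two separate ways there are only the common beginning in the top row and the common
  -- end in the bottom row. Each of these four pieces has at most one cell per level, and the common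
  -- pieces share no level with the others.
  have key : ∀ c : ℕ × ℕ, L.varCol u < c.1 → c.1 ≤ L.varCol u + φ.slots u + 5 →
      varShape (φ.slots u) (c.1 - L.varCol u) c.2 → L.OnTop u c ∨ L.OnBottom u c ∨
      (c.2 = 2 ∧ c.1 ≤ L.varCol u + 2) ∨ (c.2 = 0 ∧ L.varCol u + φ.slots u + 4 ≤ c.1) := by
    intro c c1 c2 c3
    unfold OnTop OnBottom
    unfold varShape at c3
    omega
  rcases key a a1 a2 a3 with h | h | h | h <;> rcases key b b1 b2 b3 with k | k | k | k
  all_goals first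
    | exact .inl ⟨h, k⟩
    | exact .inr ⟨h, k⟩
    | (exfalso; unfold OnTop OnBottom at *; omega)

/-- The way can be left upwards only where the two ways merge, at level `varLevel u + slots + 8`;
hence the disjunction is invariant under climbing. -/
theorem OnTop.ascends {L : Layout φ} {u : Fin N} {a b : ℕ × ℕ} (hab : L.Ascends a b)
    (h : L.OnTop u a ∨ L.varLevel u + φ.slots u + 8 ≤ L.height a) :
    L.OnTop u b ∨ L.varLevel u + φ.slots u + 8 ≤ L.height b := by
  have hh := hab.height_eq
  rcases h with h | h
  · have h3 := h.height_eq
    by_cases h4 : L.varLevel u + φ.slots u + 8 ≤ L.height b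
    · exact .inr h4
    · left
      unfold OnTop varLevel at *
      obtain ⟨b1, b2, b3, b4⟩ := L.mem_gadget (u := u) hab.right
        (by unfold varLevel; omega) (by unfold varLevel; omega)
      unfold varShape at b3
      have := hab.cases
      omega
  · right; omega

theorem OnBottom.ascends {L : Layout φ} {u : Fin N} {a b : ℕ × ℕ} (hab : L.Ascends a b)
    (h : L.OnBottom u a ∨ L.varLevel u + φ.slots u + 8 ≤ L.height a) :
    L.OnBottom u b ∨ L.varLevel u + φ.slots u + 8 ≤ L.height b := by
  have hh := hab.height_eq
  rcases h with h | h
  · have h3 := h.height_eq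
    by_cases h4 : L.varLevel u + φ.slots u + 8 ≤ L.height b
    · exact .inr h4
    · left
      unfold OnBottom varLevel at *
      obtain ⟨b1, b2, b3, b4⟩ := L.mem_gadget (u := u) hab.right
        (by unfold varLevel; omega) (by unfold varLevel; omega)
      unfold varShape at b3
      have := hab.cases
      omega
  · right; omega

/-- The bound `hu` excludes the leftmost gadget, whose column 0 shares levels with other cells of
the room. -/
theorem eq_of_height_eq_of_varCol (L : Layout φ) {u : Fin N} (hu : (m - 1) / 3 + 3 ≤ L.varCol u)
    {a b : ℕ × ℕ} (ha : a.1 = L.varCol u) (ha' : a.2 < 3) (hb : b ∈ L.Free)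
    (hab : L.height b = L.height a) : b = a := by
  rw [L.height_varCol ha] at hab
  rcases L.free_cases hb with ⟨k1, k2, k3⟩ | ⟨w, k1, k2, k3⟩ | ⟨w, k1, k2, k4, k3⟩ |
    ⟨i, k1, k2, k3⟩
  · omega
  · rcases L.varCol_trichotomy u w with rfl | h | h
    · exact Prod.ext (by omega) (by omega)
    · omega
    · omega
  · unfold varShape at k4
    rcases L.varCol_trichotomy u w with rfl | h | h <;> omega
  · have := L.zone_le_clauseCol i
    have := L.varCol_add_le_zone u
    have := (L.varPos u).2
    omega

/-- From where the target of a literal agent can be reached without detour. -/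
theorem eq_of_ascends_target {L : Layout φ} {i : Fin m} {k : Fin 3} {a b : ℕ × ℕ}
    (hab : L.Ascends a b)
    (hb : zone φ ≤ b.1 → b = L.target (.literal i k) ∨
      (b.2 = 0 ∧ b.1 ≤ (L.target (.literal i k)).1))
    (ha : zone φ ≤ a.1) :
    a = L.target (.literal i k) ∨ (a.2 = 0 ∧ a.1 ≤ (L.target (.literal i k)).1) := by
  have h1 := hab.cases
  have h2 := hab.height_eq
  rw [L.height_zone ha, L.height_zone (show zone φ ≤ b.1 by omega)] at h2
  simp only [target, Prod.ext_iff] at hb ⊢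
  have := (L.litPos i k).2
  rcases L.free_cases hab.left with ⟨k1, k2, k3⟩ | ⟨w, k1, k2, k3⟩ | ⟨w, k1, k2, k4, k3⟩ |
    ⟨j, k1, k2, k3⟩
  · have := room_add_le_zone φ i
    omega
  · have := L.varCol_add_le_zone w
    omega
  · have := L.varCol_add_le_zone w
    omega
  -- The cell to the left of a literal's target is an obstacle or lies before the zone, so within
  -- the zone the target is entered from below, and the bottom row from the left.
  · unfold clauseShape at k2
    rcases L.clauseCol_trichotomy i j with rfl | h | h <;> omega

/-! ### Trajectories that climb through the grid. -/

/-- Trajectories in a plan of minimum cost. -/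
def IsAscent (L : Layout φ) (a : ℕ → L.Free) : Prop :=
  ∀ τ, a τ = a (τ + 1) ∨ L.Ascends (a τ) (a (τ + 1))

namespace IsAscent

variable {L : Layout φ} {a b : ℕ → L.Free}

theorem climbs (ha : L.IsAscent a) : MAPF.Climbs (fun c : L.Free => L.height c) a :=
  fun τ => (ha τ).imp id fun h => h.height_eq

theorem preserves (ha : L.IsAscent a) {P : ℕ × ℕ → Prop}
    (hP : ∀ c d, L.Ascends c d → P c → P d) {t t' : ℕ} (h : t ≤ t') (ht : P (a t)) : P (a t') := by
  induction t', h using Nat.le_induction with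
  | base => exact ht
  | succ n hn ih =>
    rcases ha n with e | e
    · rwa [← e]
    · exact hP _ _ e ih

theorem height_mono (ha : L.IsAscent a) {t t' : ℕ} (h : t ≤ t') :
    L.height (a t) ≤ L.height (a t') := ha.climbs.monotone h

theorem col_mono (ha : L.IsAscent a) {t t' : ℕ} (h : t ≤ t') : (a t).1.1 ≤ (a t').1.1 :=
  ha.preserves (P := fun c => (a t).1.1 ≤ c.1)
    (fun c d hcd hc => by have := hcd.cases; omega) h le_rfl

/-- After the earlier visit the agent stays on that way until level `varLevel u + slots + 8`, which
is above all cells of the other way. -/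
theorem not_onTop_and_onBottom (ha : L.IsAscent a) {u : Fin N} {t t' : ℕ}
    (h1 : L.OnTop u (a t)) (h2 : L.OnBottom u (a t')) : False := by
  rcases le_total t t' with h | h
  · have h3 := ha.preserves (P := fun c => L.OnTop u c ∨ L.varLevel u + φ.slots u + 8 ≤ L.height c)
      (fun c d => OnTop.ascends) h (.inl h1)
    have := h2.height_eq
    unfold OnTop OnBottom varLevel at *
    omega
  · have h3 := ha.preserves
      (P := fun c => L.OnBottom u c ∨ L.varLevel u + φ.slots u + 8 ≤ L.height c)
      (fun c d => OnBottom.ascends) h (.inl h2)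
    have := h1.height_eq
    unfold OnTop OnBottom varLevel at *
    omega

theorem of_target {i : Fin m} {k : Fin 3} (ha : L.IsAscent a) {t t' : ℕ} (h : t ≤ t')
    (ht' : (a t' : ℕ × ℕ) = L.target (.literal i k)) (hz : zone φ ≤ (a t).1.1) :
    (a t : ℕ × ℕ) = L.target (.literal i k) ∨
      ((a t).1.2 = 0 ∧ (a t).1.1 ≤ (L.target (.literal i k)).1) := by
  -- Induction backwards in time from the arrival at the target.
  have : ∀ n t, t + n = t' → zone φ ≤ (a t).1.1 → (a t : ℕ × ℕ) = L.target (.literal i k) ∨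
      ((a t).1.2 = 0 ∧ (a t).1.1 ≤ (L.target (.literal i k)).1) := by
    intro n
    induction n with
    | zero =>
      rintro t rfl _
      exact .inl ht'
    | succ n ih =>
      intro t ht hz
      rcases ha t with e | e
      · rw [e] at hz ⊢
        exact ih _ (by omega) hz
      · exact eq_of_ascends_target e (ih _ (by omega)) hz
  exact this (t' - t) t (by omega) hz

end IsAscent

theorem height_le_of_le_varCol (L : Layout φ) {u : Fin N} {c : ℕ × ℕ} (hc : c ∈ L.Free)
    (h : c.1 ≤ L.varCol u) : L.height c ≤ L.varLevel u + 2 := by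
  unfold varLevel
  have := L.le_varCol u
  rcases L.free_cases hc with ⟨k1, k2, k3⟩ | ⟨w, k1, k2, k3⟩ | ⟨w, k1, k2, k4, k3⟩ |
    ⟨i, k1, k2, k3⟩
  · omega
  · rcases L.varCol_trichotomy u w with rfl | h | h <;> omega
  · rcases L.varCol_trichotomy u w with rfl | h | h <;> omega
  · have := L.zone_le_clauseCol i
    have := L.varCol_add_le_zone u
    omega

/-! ### A plan of minimum cost yields a satisfying assignment. -/

section Necessity

variable {L : Layout φ} {p : Agent N m → ℕ → L.Free}

/-- An agent that crosses a variable gadget overtakes its blocker there. -/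
theorem crosses (hp : L.inst.IsMotionPlan p) (hcf : MAPF.CollisionFree p)
    (hasc : ∀ r, L.IsAscent (p r)) {r : Agent N m} {u : Fin N} (hr : r ≠ .blocker u)
    (h0 : (L.start r).1 ≤ L.varCol u) (h1 : zone φ ≤ (L.target r).1) :
    ((∃ t, L.OnTop u (p r t)) ∧ ∃ t, L.OnBottom u (p (.blocker u) t)) ∨
      ((∃ t, L.OnBottom u (p r t)) ∧ ∃ t, L.OnTop u (p (.blocker u) t)) := by
  have s1 : (p r 0 : ℕ × ℕ) = L.start r := congrArg Subtype.val (hp r).1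
  have s2 : (p (.blocker u) 0 : ℕ × ℕ) = L.start (.blocker u) :=
    congrArg Subtype.val (hp (.blocker u)).1
  obtain ⟨T, hT⟩ := (hp r).2.1
  obtain ⟨T', hT'⟩ := (hp (.blocker u)).2.1
  have e1 : (p r (max T T') : ℕ × ℕ) = L.target r :=
    congrArg Subtype.val (hT _ (le_max_left _ _))
  have e2 : (p (.blocker u) (max T T') : ℕ × ℕ) = L.target (.blocker u) :=
    congrArg Subtype.val (hT' _ (le_max_right _ _))
  have b1 : L.height (p r 0) ≤ L.varLevel u + 2 :=
    L.height_le_of_le_varCol (p r 0).2 (by rw [s1]; exact h0)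
  have b2 : L.height (p (.blocker u) 0) = L.varLevel u + 3 := by
    rw [s2, L.height_inner (v := u)]
    all_goals simp only [start, varLevel]
    · push_cast
      ring
    · omega
    · omega
  have b3 : L.varLevel u + φ.slots u + 10 ≤ L.height (p r (max T T')) := by
    rw [e1, L.height_zone h1]
    have := L.varCol_add_le_zone u
    have := (L.varPos u).2
    unfold varLevel
    omega
  have b4 : L.height (p (.blocker u) (max T T')) = L.varLevel u + φ.slots u + 9 := by
    rw [e2, L.height_inner (v := u)]
    all_goals simp only [target, varLevel]
    · push_cast
      ring
    · omega
    · omega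
  -- The agent starts below the blocker and ends above it. The blocker stays between the levels of
  -- entrance and exit, so the common level is one to which `onTop_or_onBottom` applies.
  obtain ⟨τ, h2, h3⟩ := (hasc r).climbs.exists_eq (hasc (.blocker u)).climbs
    (t := max T T') (by omega) (by omega)
  have b5 := (hasc (.blocker u)).height_mono (Nat.zero_le τ)
  have b6 := (hasc (.blocker u)).height_mono h2
  rcases L.onTop_or_onBottom (u := u) (p r τ).2 (p (.blocker u) τ).2 h3 (by omega) (by omega)
    (fun e => (hcf r _ hr).1 τ (Subtype.ext e)) with ⟨h, k⟩ | ⟨h, k⟩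
  · exact .inl ⟨⟨τ, h⟩, τ, k⟩
  · exact .inr ⟨⟨τ, h⟩, τ, k⟩

/-- A clause agent passes through the target of a literal agent of its clause. -/
theorem exists_passes (hp : L.inst.IsMotionPlan p) (hasc : ∀ r, L.IsAscent (p r)) (j : Fin m) :
    ∃ k t, (p (.clause j) t : ℕ × ℕ) = L.target (.literal j k) := by
  have s1 : (p (.clause j) 0 : ℕ × ℕ) = L.start (.clause j) := congrArg Subtype.val (hp _).1
  obtain ⟨T, hT⟩ := (hp (.clause j)).2.1
  have e1 : (p (.clause j) T : ℕ × ℕ) = L.target (.clause j) :=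
    congrArg Subtype.val (hT _ le_rfl)
  have hz := room_add_le_zone φ j
  have hzj := L.zone_le_clauseCol j
  by_contra hno
  -- The top row of the gadget cannot be entered from the left, as only the bottom cell of the
  -- preceding column is free. Up to column 4 it is entered from a middle cell, and the free ones
  -- there are exactly the three literal targets.
  have key : ∀ τ ≤ T, (p (.clause j) τ).1.1 < L.clauseCol j ∨ (p (.clause j) τ).1.2 ≠ 2 := by
    intro τ
    induction τ with
    | zero =>
      intro _
      left
      rw [s1]
      simp only [start]
      have := (L.room j).1.2
      omega
    | succ τ ih =>
      intro hτ
      have ih := ih (by omega)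
      have hcol := (hasc (.clause j)).col_mono hτ
      rw [e1] at hcol
      simp only [target] at hcol
      rcases hasc (.clause j) τ with e | e
      · rwa [← e]
      · have h1 := e.cases
        have h2 := e.height_eq
        by_contra! h3
        have hhz : L.height (p (.clause j) (τ + 1)) = _ := L.height_zone (by omega)
        rcases L.free_cases e.left with ⟨k1, k2, k3⟩ | ⟨w, k1, k2, k3⟩ | ⟨w, k1, k2, k4, k3⟩ |
          ⟨i, k1, k2, k3⟩
        · omega
        · have := L.varCol_add_le_zone w
          omega
        · have := L.varCol_add_le_zone w
          unfold varShape at k4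
          omega
        · unfold clauseShape at k2
          rcases L.clauseCol_trichotomy i j with rfl | h | h
          · have h4 : ∃ l : Fin 3, (p (.clause i) τ).1.1 = L.clauseCol i + 2 * (l : ℕ) := by
              have : (p (.clause i) τ).1.1 = L.clauseCol i + 2 * 0 ∨
                (p (.clause i) τ).1.1 = L.clauseCol i + 2 * 1 ∨
                (p (.clause i) τ).1.1 = L.clauseCol i + 2 * 2 := by omega
              rcases this with h | h | h
              · exact ⟨0, h⟩
              · exact ⟨1, h⟩
              · exact ⟨2, h⟩
            obtain ⟨l, hl⟩ := h4
            refine hno ⟨(L.litPos i).symm l, τ, ?_⟩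
            simp only [target, Equiv.apply_symm_apply]
            exact Prod.ext hl (by omega)
          · omega
          · omega
  have := key T le_rfl
  rw [e1] at this
  simp [target] at this

theorem satisfiable_of_plan (hp : L.inst.IsMotionPlan p) (hcf : MAPF.CollisionFree p)
    (hasc : ∀ r, L.IsAscent (p r)) : φ.Satisfiable := by
  classical
  -- A variable is true if its blocker uses the top way.
  refine ⟨fun v => decide (∃ t, L.OnTop v (p (.blocker v) t)), fun j => ?_⟩
  obtain ⟨k, t, ht⟩ := exists_passes hp hasc j
  refine ⟨k, ?_⟩
  by_contra hA
  have hz := room_add_le_zone φ j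
  have hzt : ∀ k, zone φ ≤ (L.target (.literal j k)).1 := by
    intro k
    have := L.zone_le_clauseCol j
    simp only [target]
    omega
  have hzc : zone φ ≤ (L.target (.clause j)).1 := by
    have := L.zone_le_clauseCol j
    simp only [target]
    omega
  have sc : (p (.clause j) 0 : ℕ × ℕ) = L.start (.clause j) := congrArg Subtype.val (hp _).1
  have sl : (p (.literal j k) 0 : ℕ × ℕ) = L.start (.literal j k) :=
    congrArg Subtype.val (hp _).1
  have hcs : (L.start (.clause j)).1 ≤ (m - 1) / 3 := by
    have := (L.room j).1.2
    simp only [start]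
    omega
  have hslot := L.slot_lt j k
  have hls1 : L.varCol (φ j k).1 + 4 ≤ (L.start (.literal j k)).1 := by
    simp only [start]
    omega
  have hls2 : (L.start (.literal j k)).1 ≤ L.varCol (φ j k).1 + φ.slots (φ j k).1 + 3 := by
    simp only [start]
    omega
  have hside : ((φ j k).2 = true ∧ L.OnTop (φ j k).1 (p (.literal j k) 0)) ∨
      ((φ j k).2 = false ∧ L.OnBottom (φ j k).1 (p (.literal j k) 0)) := by
    rw [sl]
    unfold OnTop OnBottom
    cases hb : (φ j k).2
    · right
      have : (L.start (.literal j k)).2 = 0 := by simp [start, hb]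
      refine ⟨rfl, ?_⟩
      omega
    · left
      have : (L.start (.literal j k)).2 = 2 := by simp [start, hb]
      refine ⟨rfl, ?_⟩
      omega
  -- Levels never drop, so the literal agent is never above its target.
  have hnotyet : L.height (p (.literal j k) t) ≤ L.height (p (.clause j) t) := by
    obtain ⟨T, hT⟩ := (hp (.literal j k)).2.1
    rw [ht, ← show (p (.literal j k) (max T t) : ℕ × ℕ) = L.target (.literal j k) from
      congrArg Subtype.val (hT _ (le_max_left _ _))]
    exact (hasc _).height_mono (le_max_right _ _)
  have hvc := L.le_varCol (φ j k).1
  have hstart : L.height (p (.clause j) 0) ≤ L.height (p (.literal j k) 0) := by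
    have h1 := L.height_le_of_le_varCol (u := (φ j k).1) (p (.clause j) 0).2
      (by rw [sc]; omega)
    refine h1.trans ?_
    rcases hside with ⟨-, h⟩ | ⟨-, h⟩
    · have := h.height_eq
      unfold OnTop varLevel at *
      rw [sl] at *
      omega
    · have := h.height_eq
      unfold OnBottom varLevel at *
      rw [sl] at *
      omega
  obtain ⟨τ, hτ, heq⟩ := (hasc (.clause j)).climbs.exists_eq (hasc (.literal j k)).climbs
    hstart hnotyet
  have hne : (p (.clause j) τ : ℕ × ℕ) ≠ p (.literal j k) τ :=
    fun e => (hcf _ _ (by simp)).1 τ (Subtype.ext e)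
  have hlcol := (hasc (.literal j k)).col_mono (Nat.zero_le τ)
  rw [sl] at hlcol
  rcases L.free_cases (p (.literal j k) τ).2 with ⟨k1, k2, k3⟩ | ⟨w, k1, k2, k3⟩ |
    ⟨w, k1, k2, k4, k3⟩ | ⟨i, k1, k2, k3⟩
  · omega
  -- The literal agent started to the right of its own column 0, so `w` is a later gadget, and there
  -- the level determines the cell.
  · refine hne (L.eq_of_height_eq_of_varCol (u := w) ?_ k1 k2 (p (.clause j) τ).2 heq)
    rcases L.varCol_trichotomy (φ j k).1 w with rfl | h | h <;> omega
  · have hsplit := L.onTop_or_onBottom (u := w) (p (.clause j) τ).2 (p (.literal j k) τ).2 heq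
      (by unfold varShape at k4; unfold varLevel; omega)
      (by unfold varShape at k4; unfold varLevel; omega) hne
    have hcw := crosses hp hcf hasc (r := .clause j) (u := w) (by simp)
      (by have := L.le_varCol w; omega) hzc
    -- In each case the blocker of `w` is on the way of the clause agent, which contradicts `hcw`.
    -- In the literal's own gadget this is where the falsity of the literal enters; in a later
    -- gadget the literal agent crosses too and avoids the blocker's way.
    have hlw : L.OnTop w (p (.clause j) τ) ∧ L.OnBottom w (p (.literal j k) τ) ∧
        (∃ t, L.OnTop w (p (.blocker w) t)) ∨
        L.OnBottom w (p (.clause j) τ) ∧ L.OnTop w (p (.literal j k) τ) ∧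
        (∃ t, L.OnBottom w (p (.blocker w) t)) := by
      rcases L.varCol_trichotomy (φ j k).1 w with hw | h | h
      · rw [hw] at hside hA
        rcases hsplit with ⟨h1, h2⟩ | ⟨h1, h2⟩
        · rcases hside with ⟨h3, h4⟩ | ⟨h3, h4⟩
          · exact ((hasc _).not_onTop_and_onBottom h4 h2).elim
          · left
            refine ⟨h1, h2, ?_⟩
            simpa [h3] using hA
        · rcases hside with ⟨h3, h4⟩ | ⟨h3, h4⟩
          · right
            refine ⟨h1, h2, ?_⟩
            rcases hcw with ⟨h5, h6⟩ | ⟨h5, h6⟩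
            · exact h6
            · simp [h3] at hA
              exact absurd h6 (by simpa using hA)
          · exact ((hasc _).not_onTop_and_onBottom h2 h4).elim
      · have := crosses hp hcf hasc (r := .literal j k) (u := w) (by simp) (by omega) (hzt k)
        rcases hsplit with ⟨h1, h2⟩ | ⟨h1, h2⟩ <;> rcases this with ⟨⟨t, h3⟩, h4⟩ | ⟨⟨t, h3⟩, h4⟩
        · exact ((hasc _).not_onTop_and_onBottom h3 h2).elim
        · exact .inl ⟨h1, h2, h4⟩
        · exact .inr ⟨h1, h2, h4⟩
        · exact ((hasc _).not_onTop_and_onBottom h2 h3).elim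
      · omega
    rcases hlw with ⟨h1, -, t1, h2⟩ | ⟨h1, -, t1, h2⟩ <;>
      rcases hcw with ⟨⟨t2, h3⟩, t3, h4⟩ | ⟨⟨t2, h3⟩, t3, h4⟩
    · exact (hasc _).not_onTop_and_onBottom h2 h4
    · exact (hasc _).not_onTop_and_onBottom h1 h3
    · exact (hasc _).not_onTop_and_onBottom h3 h1
    · exact (hasc _).not_onTop_and_onBottom h4 h2
  · have hzi := L.zone_le_clauseCol i
    have hcz : zone φ ≤ (p (.clause j) τ).1.1 := by
      rcases L.free_cases (p (.clause j) τ).2 with ⟨g1, g2, g3⟩ | ⟨w, g1, g2, g3⟩ |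
        ⟨w, g1, g2, g4, g3⟩ | ⟨i', g1, g2, g3⟩
      · omega
      · have := L.varCol_add_le_zone w
        have := (L.varPos w).2
        omega
      · have := L.varCol_add_le_zone w
        have := (L.varPos w).2
        unfold varShape at g4
        omega
      · have := L.zone_le_clauseCol i'
        omega
    obtain ⟨T, hT⟩ := (hp (.literal j k)).2.1
    have hl := (hasc (.literal j k)).of_target (i := j) (k := k) (le_max_right T τ)
      (congrArg Subtype.val (hT _ (le_max_left _ _))) (by omega)
    have hc := (hasc (.clause j)).of_target hτ ht hcz
    rw [L.height_zone hcz, k3] at heq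
    -- Both are on the bottom row up to the target's column or on the target itself, and there
    -- column plus row determines the cell.
    refine hne ?_
    simp only [target, Prod.ext_iff] at hl hc ⊢
    omega

end Necessity

/-! ### Roads, and lanes along them. -/

def OnSide (L : Layout φ) (b : Bool) (v : Fin N) (c : ℕ × ℕ) : Prop :=
  (b = true ∧ L.OnTop v c) ∨ (b = false ∧ L.OnBottom v c)

/-- The cells of a variable gadget that belong to both ways through it. -/
def Shared (L : Layout φ) (v : Fin N) (c : ℕ × ℕ) : Prop :=
  (L.varCol v + 1 ≤ c.1 ∧ c.1 ≤ L.varCol v + 2 ∧ c.2 = 2) ∨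
    (L.varCol v + φ.slots v + 4 ≤ c.1 ∧ c.1 ≤ L.varCol v + φ.slots v + 5 ∧ c.2 = 0)

/-- A road from the room to the clause gadgets, along the sides of the variable gadgets that are
given by `σ` (`true` for the top one), and on along the bottom row of the clause gadgets. -/
def Road (L : Layout φ) (σ : Fin N → Bool) (c : ℕ × ℕ) : Prop :=
  (∃ v, c.1 = L.varCol v ∧ c.2 < 3) ∨ (∃ v, L.OnSide (σ v) v c ∨ L.Shared v c) ∨
    (zone φ ≤ c.1 ∧ c.1 < zone φ + 7 * m ∧ c.2 = 0)

section Roads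

variable {L : Layout φ} {σ : Fin N → Bool} {c : ℕ × ℕ}

theorem free_of_varShape {v : Fin N} (x : ℕ) (h1 : c.1 = L.varCol v + x)
    (h2 : varShape (φ.slots v) x c.2) : c ∈ L.Free := .inr (.inl ⟨v, x, h1, h2⟩)

theorem free_of_clauseShape {j : Fin m} (x : ℕ) (h1 : c.1 = L.clauseCol j + x)
    (h2 : clauseShape x c.2) : c ∈ L.Free := .inr (.inr ⟨j, x, h1, h2⟩)

theorem Shared.free {v : Fin N} (h : L.Shared v c) : c ∈ L.Free := by
  unfold Shared at h
  refine free_of_varShape (v := v) (c.1 - L.varCol v) (by omega) ?_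
  unfold varShape
  omega

theorem OnTop.free {v : Fin N} (h : L.OnTop v c) : c ∈ L.Free := by
  unfold OnTop at h
  refine free_of_varShape (v := v) (c.1 - L.varCol v) (by omega) ?_
  unfold varShape
  omega

theorem OnBottom.free {v : Fin N} (h : L.OnBottom v c) : c ∈ L.Free := by
  unfold OnBottom at h
  refine free_of_varShape (v := v) (c.1 - L.varCol v) (by omega) ?_
  unfold varShape
  omega

theorem Road.free (h : L.Road σ c) : c ∈ L.Free := by
  rcases h with ⟨v, h1, h2⟩ | ⟨v, (⟨-, h⟩ | ⟨-, h⟩) | h⟩ | ⟨h1, h2, h3⟩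
  · refine free_of_varShape (v := v) 0 (by omega) ?_
    unfold varShape
    omega
  · exact h.free
  · exact h.free
  · exact h.free
  -- Clause gadgets are seven columns wide, so quotient and remainder by 7 locate the cell.
  · have hlt : (c.1 - zone φ) / 7 < m := by omega
    refine free_of_clauseShape (j := L.clausePos.symm ⟨(c.1 - zone φ) / 7, hlt⟩)
      ((c.1 - zone φ) % 7) ?_ ?_
    · rw [clauseCol_eq, Equiv.apply_symm_apply]
      simp only
      omega
    · unfold clauseShape
      omega

theorem ascends_right {d : ℕ × ℕ} (hc : c ∈ L.Free) (hd : d ∈ L.Free) (h1 : d.1 = c.1 + 1)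
    (h2 : d.2 = c.2) : L.Ascends c d :=
  ⟨hc, hd, .inr ⟨h2.symm, .inl h1.symm⟩, L.height_right hc hd h1 h2⟩

theorem ascends_down {d : ℕ × ℕ} {v : Fin N} (hc : c ∈ L.Free) (hd : d ∈ L.Free)
    (h1 : L.varCol v < c.1) (h2 : c.1 ≤ L.varCol v + φ.slots v + 5) (h3 : d.1 = c.1)
    (h4 : d.2 + 1 = c.2) : L.Ascends c d := by
  refine ⟨hc, hd, .inl ⟨h3.symm, .inr h4⟩, ?_⟩
  rw [L.height_inner h1 h2, L.height_inner (v := v) (by omega) (by omega), h3]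
  omega

theorem ascends_up_zone {d : ℕ × ℕ} (hc : c ∈ L.Free) (hd : d ∈ L.Free)
    (h1 : zone φ ≤ c.1) (h3 : d.1 = c.1) (h4 : d.2 = c.2 + 1) : L.Ascends c d := by
  refine ⟨hc, hd, .inl ⟨h3.symm, .inl h4.symm⟩, ?_⟩
  rw [L.height_zone h1, L.height_zone (by omega), h3]
  omega

theorem ascends_up_varCol {d : ℕ × ℕ} {v : Fin N} (hc : c ∈ L.Free) (hd : d ∈ L.Free)
    (h1 : c.1 = L.varCol v) (h3 : d.1 = c.1) (h4 : d.2 = c.2 + 1) : L.Ascends c d := by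
  refine ⟨hc, hd, .inl ⟨h3.symm, .inl h4.symm⟩, ?_⟩
  rw [L.height_varCol h1, L.height_varCol (v := v) (by omega)]
  omega

theorem ascends_up_room {d : ℕ × ℕ} (hc : c ∈ L.Free) (hd : d ∈ L.Free)
    (h1 : c.1 ≤ (m - 1) / 3) (h3 : d.1 = c.1) (h4 : d.2 = c.2 + 1) : L.Ascends c d := by
  refine ⟨hc, hd, .inl ⟨h3.symm, .inl h4.symm⟩, ?_⟩
  rw [L.height_room h1, L.height_room (by omega), h3]
  omega

theorem Road.of_shared {v : Fin N} (h : L.Shared v c) : L.Road σ c := .inr (.inl ⟨v, .inr h⟩)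

theorem Road.of_onSide {v : Fin N} (h : L.OnSide (σ v) v c) : L.Road σ c :=
  .inr (.inl ⟨v, .inl h⟩)

/-- Along a road one gets from column to column. -/
theorem Road.ascend (h : L.Road σ c) {X : ℕ} (hX : X < zone φ + 7 * m) (hc : c.1 < X) :
    ∃ d, L.Road σ d ∧ L.Ascends c d ∧ d.1 ≤ X := by
  have hf := h.free
  rcases h with ⟨v, h1, h2⟩ | ⟨v, (⟨hσ, h⟩ | ⟨hσ, h⟩) | h⟩ | ⟨h1, h2, h3⟩
  · by_cases h3 : c.2 = 2
    · have hd : L.Shared v (c.1 + 1, c.2) := by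
        unfold Shared
        omega
      exact ⟨_, .of_shared hd, ascends_right hf hd.free rfl rfl, hc⟩
    · have hd : L.Road σ (c.1, c.2 + 1) := .inl ⟨v, h1, by simp only; omega⟩
      exact ⟨_, hd, ascends_up_varCol hf hd.free h1 rfl rfl, hc.le⟩
  · unfold OnTop at h
    by_cases h1 : c.1 = L.varCol v + φ.slots v + 4
    · have hd : L.Road σ (c.1, c.2 - 1) := by
        by_cases h2 : c.2 = 2
        · refine .of_onSide (v := v) (.inl ⟨hσ, ?_⟩)
          unfold OnTop
          simp only
          omega
        · refine .of_shared (v := v) ?_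
          unfold Shared
          simp only
          omega
      exact ⟨_, hd, ascends_down (v := v) hf hd.free (by omega) (by omega) rfl
        (by simp only; omega), hc.le⟩
    · have hd : L.Road σ (c.1 + 1, c.2) := by
        refine .of_onSide (v := v) (.inl ⟨hσ, ?_⟩)
        unfold OnTop
        simp only
        omega
      exact ⟨_, hd, ascends_right hf hd.free rfl rfl, hc⟩
  · unfold OnBottom at h
    by_cases h1 : c.2 = 1
    · have hd : L.Road σ (c.1, c.2 - 1) := by
        refine .of_onSide (v := v) (.inr ⟨hσ, ?_⟩)
        unfold OnBottom
        simp only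
        omega
      exact ⟨_, hd, ascends_down (v := v) hf hd.free (by omega) (by omega) rfl
        (by simp only; omega), hc.le⟩
    · have hd : L.Road σ (c.1 + 1, c.2) := by
        by_cases h2 : c.1 = L.varCol v + φ.slots v + 3
        · refine .of_shared (v := v) ?_
          unfold Shared
          simp only
          omega
        · refine .of_onSide (v := v) (.inr ⟨hσ, ?_⟩)
          unfold OnBottom
          simp only
          omega
      exact ⟨_, hd, ascends_right hf hd.free rfl rfl, hc⟩
  · unfold Shared at h
    by_cases h1 : c.1 = L.varCol v + φ.slots v + 5
    · have hd : L.Road σ (c.1 + 1, c.2) := by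
        rcases L.varCol_succ v with ⟨w, h2, -⟩ | ⟨h2, -⟩
        · exact .inl ⟨w, by simp only; omega, by simp only; omega⟩
        · refine .inr (.inr ?_)
          simp only
          omega
      exact ⟨_, hd, ascends_right hf hd.free rfl rfl, hc⟩
    -- The top cell of column 2 is the junction where `σ` chooses the way.
    · by_cases h2 : c.1 = L.varCol v + 2 ∧ σ v = false
      · have hd : L.Road σ (c.1, c.2 - 1) := by
          refine .of_onSide (v := v) (.inr ⟨h2.2, ?_⟩)
          unfold OnBottom
          simp only
          omega
        exact ⟨_, hd, ascends_down (v := v) hf hd.free (by omega) (by omega) rfl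
          (by simp only; omega), hc.le⟩
      · have hd : L.Road σ (c.1 + 1, c.2) := by
          by_cases h3 : c.1 = L.varCol v + 2
          · refine .of_onSide (v := v) (.inl ⟨by simpa [h3] using h2, ?_⟩)
            unfold OnTop
            simp only
            omega
          · refine .of_shared (v := v) ?_
            unfold Shared
            simp only
            omega
        exact ⟨_, hd, ascends_right hf hd.free rfl rfl, hc⟩
  · have hd : L.Road σ (c.1 + 1, c.2) := by
      refine .inr (.inr ?_)
      simp only
      omega
    exact ⟨_, hd, ascends_right hf hd.free rfl rfl, hc⟩

/-- Which cells of a variable gadget lie on a road. -/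
theorem Road.onSide_of_onTop (h : L.Road σ c) {v : Fin N} (hc : L.OnTop v c) : σ v = true := by
  have := L.varCol_add_le_zone v
  unfold OnTop at hc
  rcases h with ⟨w, h1, h2⟩ | ⟨w, (⟨hσ, h⟩ | ⟨hσ, h⟩) | h⟩ | ⟨h1, h2, h3⟩
  · rcases L.varCol_trichotomy v w with rfl | h | h <;> omega
  · unfold OnTop at h
    rcases L.varCol_trichotomy v w with rfl | h | h
    · exact hσ
    · omega
    · omega
  · unfold OnBottom at h
    rcases L.varCol_trichotomy v w with rfl | h | h <;> omega
  · unfold Shared at h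
    rcases L.varCol_trichotomy v w with rfl | h | h <;> omega
  · omega

theorem Road.onSide_of_onBottom (h : L.Road σ c) {v : Fin N} (hc : L.OnBottom v c) :
    σ v = false := by
  have := L.varCol_add_le_zone v
  unfold OnBottom at hc
  rcases h with ⟨w, h1, h2⟩ | ⟨w, (⟨hσ, h⟩ | ⟨hσ, h⟩) | h⟩ | ⟨h1, h2, h3⟩
  · rcases L.varCol_trichotomy v w with rfl | h | h <;> omega
  · unfold OnTop at h
    rcases L.varCol_trichotomy v w with rfl | h | h <;> omega
  · unfold OnBottom at h
    rcases L.varCol_trichotomy v w with rfl | h | h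
    · exact hσ
    · omega
    · omega
  · unfold Shared at h
    rcases L.varCol_trichotomy v w with rfl | h | h <;> omega
  · omega

theorem Road.eq_of_onSide (h : L.Road σ c) {b : Bool} {v : Fin N} (hc : L.OnSide b v c) :
    σ v = b := by
  rcases hc with ⟨rfl, hc⟩ | ⟨rfl, hc⟩
  · exact h.onSide_of_onTop hc
  · exact h.onSide_of_onBottom hc

theorem Road.snd_eq_zero (h : L.Road σ c) (hc : zone φ ≤ c.1) : c.2 = 0 := by
  rcases h with ⟨w, h1, h2⟩ | ⟨w, (⟨hσ, h⟩ | ⟨hσ, h⟩) | h⟩ | ⟨h1, h2, h3⟩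
  · have := L.varCol_add_le_zone w
    omega
  · have := L.varCol_add_le_zone w
    unfold OnTop at h
    omega
  · have := L.varCol_add_le_zone w
    unfold OnBottom at h
    omega
  · have := L.varCol_add_le_zone w
    unfold Shared at h
    omega
  · exact h3

theorem height_le_of_le_exit {v : Fin N} (hc : c ∈ L.Free)
    (h : c.1 ≤ L.varCol v + φ.slots v + 5) : L.height c ≤ L.varLevel v + φ.slots v + 9 := by
  unfold varLevel
  have := L.le_varCol v
  rcases L.free_cases hc with ⟨k1, k2, k3⟩ | ⟨w, k1, k2, k3⟩ | ⟨w, k1, k2, k4, k3⟩ |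
    ⟨i, k1, k2, k3⟩
  · omega
  · rcases L.varCol_trichotomy v w with rfl | h | h <;> omega
  · unfold varShape at k4
    rcases L.varCol_trichotomy v w with rfl | h | h <;> omega
  · have := L.zone_le_clauseCol i
    have := L.varCol_add_le_zone v
    omega

theorem height_lt_of_lt_zone (j : Fin m) (hc : c ∈ L.Free) (h : c.1 < zone φ) :
    L.height c < zone φ + 4 * N := by
  have := room_add_le_zone φ j
  rcases L.free_cases hc with ⟨k1, k2, k3⟩ | ⟨w, k1, k2, k3⟩ | ⟨w, k1, k2, k4, k3⟩ |
    ⟨i, k1, k2, k3⟩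
  · omega
  · have := L.varCol_add_le_zone w
    have := (L.varPos w).2
    omega
  · have := L.varCol_add_le_zone w
    have := (L.varPos w).2
    unfold varShape at k4
    omega
  · have := L.zone_le_clauseCol i
    omega

theorem clauseCol_add_le (L : Layout φ) (j : Fin m) : L.clauseCol j + 7 ≤ zone φ + 7 * m := by
  have := (L.clausePos j).2
  rw [clauseCol_eq]
  omega

theorem Road.height_le (j : Fin m) (h : L.Road σ c) {X : ℕ} (hX : zone φ ≤ X) (hc : c.1 ≤ X) :
    L.height c ≤ X + 4 * N := by
  by_cases hz : zone φ ≤ c.1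
  · have := h.snd_eq_zero hz
    rw [L.height_zone hz]
    omega
  · have := height_lt_of_lt_zone j h.free (by omega)
    omega

/-- The level as a function on the vertices of the instance. -/
noncomputable def level (L : Layout φ) (c : L.Free) : ℤ := L.height c

/-- Membership of `d` is asked for every proof of freeness, so that the next cell can be given as a
plain pair; its freeness then comes from `Ascends`. -/
theorem isLane_of_ascends {P : Set L.Free} {g : L.Free}
    (h1 : ∀ c ∈ P, c ≠ g → ∃ d : ℕ × ℕ, (∀ hd : d ∈ L.Free, ⟨d, hd⟩ ∈ P) ∧ L.Ascends c d)
    (h2 : ∀ c ∈ P, L.height c ≤ L.height g) : MAPF.IsLane L.inst.graph L.level P g where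
  ascend c hc hcg := by
    obtain ⟨d, hd, hcd⟩ := h1 c hc hcg
    exact ⟨⟨d, hcd.right⟩, hd _, hcd.adj, hcd.height_eq⟩
  le := h2

/-- The lane of a literal agent along a road. -/
def literalLane (L : Layout φ) (σ : Fin N → Bool) (j : Fin m) (k : Fin 3) : Set L.Free :=
  {c | (L.Road σ c ∧ L.height (L.start (.literal j k)) ≤ L.height c ∧
    c.1.1 ≤ (L.target (.literal j k)).1) ∨ c.1 = L.target (.literal j k)}

theorem zone_le_target_literal (L : Layout φ) (j : Fin m) (k : Fin 3) :
    zone φ ≤ (L.target (.literal j k)).1 ∧ (L.target (.literal j k)).1 < zone φ + 7 * m := by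
  have := L.zone_le_clauseCol j
  have := L.clauseCol_add_le j
  have := (L.litPos j k).2
  simp only [target]
  omega

theorem isLane_literalLane (L : Layout φ) (σ : Fin N → Bool) (j : Fin m) (k : Fin 3) :
    MAPF.IsLane L.inst.graph L.level (L.literalLane σ j k) (L.inst.trg (.literal j k)) := by
  obtain ⟨hz, hz'⟩ := L.zone_le_target_literal j k
  refine isLane_of_ascends ?_ ?_
  · rintro ⟨c, hc⟩ (⟨h1, h2, h3⟩ | h) hne
    · rcases h3.lt_or_eq with h3 | h3
      · obtain ⟨d, hd, hcd, hdX⟩ := h1.ascend hz' h3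
        refine ⟨d, fun _ => .inl ⟨hd, ?_, hdX⟩, hcd⟩
        exact h2.trans (by rw [hcd.height_eq]; omega)
      · refine ⟨L.target (.literal j k), fun _ => .inr rfl,
          ascends_up_zone hc (L.target_free _) (h3 ▸ hz) h3.symm ?_⟩
        rw [h1.snd_eq_zero (h3 ▸ hz)]
        rfl
    · exact absurd (Subtype.ext h) hne
  · rintro ⟨c, hc⟩ (⟨h1, h2, h3⟩ | h)
    · refine (h1.height_le j hz h3).trans ?_
      change _ ≤ L.height (L.target (.literal j k))
      rw [L.height_zone hz]
      omega
    · exact (congrArg L.height h).le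

/-- The lane of a blocker along a road. -/
def blockerLane (L : Layout φ) (σ : Fin N → Bool) (v : Fin N) : Set L.Free :=
  {c | L.Road σ c ∧ L.varLevel v + 3 ≤ L.height c ∧ c.1.1 ≤ L.varCol v + φ.slots v + 5}

theorem isLane_blockerLane (L : Layout φ) (σ : Fin N → Bool) (v : Fin N) :
    MAPF.IsLane L.inst.graph L.level (L.blockerLane σ v) (L.inst.trg (.blocker v)) := by
  have hv := L.varCol_add_le_zone v
  refine isLane_of_ascends ?_ ?_
  · rintro ⟨c, hc⟩ ⟨h1, h2, h3⟩ hne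
    have h4 : c.1 < L.varCol v + φ.slots v + 5 := by
      refine lt_of_le_of_ne h3 fun h4 => hne (Subtype.ext ?_)
      obtain ⟨g1, g2, g3, -⟩ := L.mem_gadget hc h2 (height_le_of_le_exit hc h3)
      unfold varShape at g3
      change c = L.target (.blocker v)
      refine Prod.ext ?_ ?_
      · simp only [target]
        omega
      · simp only [target]
        omega
    obtain ⟨d, hd, hcd, hdX⟩ := h1.ascend (X := L.varCol v + φ.slots v + 5) (by omega) h4
    refine ⟨d, fun _ => ⟨hd, ?_, hdX⟩, hcd⟩
    exact h2.trans (by rw [hcd.height_eq]; omega)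
  · rintro ⟨c, hc⟩ ⟨h1, h2, h3⟩
    refine (height_le_of_le_exit hc h3).trans ?_
    change _ ≤ L.height (L.target (.blocker v))
    rw [L.height_inner (v := v)]
    all_goals simp only [target, varLevel]
    all_goals omega

/-- The lane of a clause agent that goes through the target of the `k`-th literal agent. -/
def clauseLane (L : Layout φ) (σ : Fin N → Bool) (j : Fin m) (k : Fin 3) : Set L.Free :=
  {c | (c.1.1 ≤ (m - 1) / 3 ∧ c.1.2 < 3 ∧
      ((c.1.2 = (L.start (.clause j)).2 ∧ (L.start (.clause j)).1 ≤ c.1.1) ∨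
        (c.1.1 = (m - 1) / 3 ∧ (L.start (.clause j)).2 ≤ c.1.2))) ∨
    (L.Road σ c ∧ (m - 1) / 3 < c.1.1 ∧ c.1.1 ≤ (L.target (.literal j k)).1) ∨
    c.1 = L.target (.literal j k) ∨
    (c.1.2 = 2 ∧ (L.target (.literal j k)).1 ≤ c.1.1 ∧ c.1.1 ≤ (L.target (.clause j)).1)}

/-- The lane goes right to the last column of the room, up to its top row, along the road to the
column of the literal's target, up through that target to the top row, and right to the end. -/
theorem isLane_clauseLane (L : Layout φ) (σ : Fin N → Bool) (j : Fin m) (k : Fin 3) :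
    MAPF.IsLane L.inst.graph L.level (L.clauseLane σ j k) (L.inst.trg (.clause j)) := by
  obtain ⟨hz, hz'⟩ := L.zone_le_target_literal j k
  have hj := room_add_le_zone φ j
  have hk := (L.litPos j k).2
  have hct : L.height (L.target (.clause j)) = L.clauseCol j + 6 + 4 * N := by
    rw [L.height_zone]
    all_goals simp only [target] at hz ⊢
    all_goals omega
  refine isLane_of_ascends ?_ ?_
  · rintro ⟨⟨x, y⟩, hc⟩ (⟨h1, h2, h3⟩ | ⟨h1, h2, h3⟩ | h | ⟨h1, h2, h3⟩) hne
    · simp only at h1 h2 h3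
      by_cases h4 : x = (m - 1) / 3
      · by_cases h5 : y = 2
        · obtain ⟨v, hv, -⟩ := L.varCol_first (φ j 0).1.pos
          have hd : L.Shared v (x + 1, y) := by
            unfold Shared
            omega
          refine ⟨(x + 1, y), fun _ => .inr (.inl ⟨.of_shared hd, ?_, ?_⟩),
            ascends_right hc hd.free rfl rfl⟩ <;> simp only <;> omega
        · have hd : (x, y + 1) ∈ L.Free := .inl ⟨h1, by simp only; omega⟩
          refine ⟨(x, y + 1), fun _ => .inl ⟨h1, ?_, .inr ⟨h4, ?_⟩⟩,
            ascends_up_room hc hd h1 rfl rfl⟩ <;> simp only <;> omega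
      · have hd : (x + 1, y) ∈ L.Free := .inl ⟨by simp only; omega, h2⟩
        refine ⟨(x + 1, y), fun _ => .inl ⟨?_, h2, .inl ⟨?_, ?_⟩⟩,
          ascends_right hc hd rfl rfl⟩ <;> simp only <;> omega
    · rcases h3.lt_or_eq with h3 | h3
      · obtain ⟨d, hd, hcd, hdX⟩ := h1.ascend hz' h3
        refine ⟨d, fun _ => .inr (.inl ⟨hd, ?_, hdX⟩), hcd⟩
        have := hcd.cases
        simp only at h2 this ⊢
        omega
      · refine ⟨L.target (.literal j k), fun _ => .inr (.inr (.inl rfl)),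
          ascends_up_zone hc (L.target_free _) (h3 ▸ hz) h3.symm ?_⟩
        rw [h1.snd_eq_zero (h3 ▸ hz)]
        rfl
    · simp only at h
      have hd : (x, 2) ∈ L.Free := by
        refine free_of_clauseShape (j := j) (2 * (L.litPos j k : ℕ)) (congrArg Prod.fst h) ?_
        unfold clauseShape
        omega
      refine ⟨(x, 2), fun _ => .inr (.inr (.inr ⟨rfl, ?_, ?_⟩)),
        ascends_up_zone hc hd ?_ rfl ?_⟩ <;> simp [target, Prod.ext_iff] at h hz ⊢ <;> omega
    · have h4 : x < (L.target (.clause j)).1 := by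
        refine lt_of_le_of_ne h3 fun h4 => hne (Subtype.ext ?_)
        exact Prod.ext h4 h1
      simp only [target] at h1 h2 h3 h4
      have hd : (x + 1, y) ∈ L.Free := by
        refine free_of_clauseShape (j := j) (x + 1 - L.clauseCol j) (by simp only; omega) ?_
        unfold clauseShape
        omega
      refine ⟨(x + 1, y), fun _ => .inr (.inr (.inr ⟨h1, ?_, ?_⟩)),
        ascends_right hc hd rfl rfl⟩ <;> simp only [target] <;> omega
  · have hX : (L.target (.literal j k)).1 ≤ L.clauseCol j + 4 := by
      simp only [target]
      omega
    change ∀ c ∈ _, _ ≤ L.height (L.target (.clause j))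
    rw [hct]
    rintro ⟨⟨x, y⟩, hc⟩ (⟨h1, h2, h3⟩ | ⟨h1, h2, h3⟩ | h | ⟨h1, h2, h3⟩)
    · rw [L.height_room h1]
      simp only at h1 h2 ⊢
      omega
    · refine (h1.height_le j hz h3).trans ?_
      omega
    · simp only at h
      refine (congrArg L.height h).le.trans ?_
      rw [L.height_zone hz]
      simp only [target] at hX ⊢
      omega
    · rw [L.height_zone (hz.trans h2)]
      simp only [target] at h1 h3 ⊢
      omega

end Roads

/-! ### Start positions, stepping aside, and distances. -/

theorem start_literal_onSide (L : Layout φ) (j : Fin m) (k : Fin 3) :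
    L.OnSide (φ j k).2 (φ j k).1 (L.start (.literal j k)) := by
  have := L.slot_lt j k
  unfold OnSide OnTop OnBottom
  cases h : (φ j k).2 <;> simp [start, h] <;> omega

theorem start_literal_col (L : Layout φ) (j : Fin m) (k : Fin 3) :
    L.varCol (φ j k).1 + 4 ≤ (L.start (.literal j k)).1 ∧
      (L.start (.literal j k)).1 ≤ L.varCol (φ j k).1 + φ.slots (φ j k).1 + 3 := by
  have := L.slot_lt j k
  simp only [start]
  omega

theorem height_start_literal (L : Layout φ) (j : Fin m) (k : Fin 3) :
    L.height (L.start (.literal j k)) =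
      L.varLevel (φ j k).1 + 8 + L.slot j k - (if (φ j k).2 then 2 else 0 : ℕ) := by
  have h := L.start_literal_col j k
  rw [L.height_inner (v := (φ j k).1) (by omega) (by omega)]
  simp only [start, varLevel]
  push_cast
  ring

theorem height_start_literal_bounds (L : Layout φ) (j : Fin m) (k : Fin 3) :
    L.varLevel (φ j k).1 + 6 ≤ L.height (L.start (.literal j k)) ∧
      L.height (L.start (.literal j k)) ≤ L.varLevel (φ j k).1 + φ.slots (φ j k).1 + 7 := by
  have := L.slot_lt j k
  rw [height_start_literal]
  split_ifs <;> omega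

theorem varLevel_trichotomy (L : Layout φ) (u v : Fin N) :
    u = v ∨ L.varLevel u + φ.slots u + 10 ≤ L.varLevel v ∨
      L.varLevel v + φ.slots v + 10 ≤ L.varLevel u := by
  unfold varLevel
  rcases L.varCol_trichotomy u v with h | h | h
  · exact .inl h
  · right; left
    omega
  · right; right
    omega

/-- Different gadgets have disjoint ranges of start levels; within a gadget, on one side, the level
determines the slot. -/
theorem literal_eq_of_height_eq (L : Layout φ) {j j' : Fin m} {k k' : Fin 3}
    (hb : (φ j k).1 = (φ j' k').1 → (φ j k).2 = (φ j' k').2)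
    (h : L.height (L.start (.literal j k)) = L.height (L.start (.literal j' k'))) :
    Agent.literal (N := N) j k = .literal j' k' := by
  have h1 := L.height_start_literal_bounds j k
  have h2 := L.height_start_literal_bounds j' k'
  have hv : (φ j k).1 = (φ j' k').1 := by
    rcases L.varLevel_trichotomy (φ j k).1 (φ j' k').1 with h | h | h
    · exact h
    · omega
    · omega
  rw [height_start_literal, height_start_literal, hv, hb hv] at h
  obtain ⟨rfl, rfl⟩ := L.slot_inj j k j' k' (Prod.ext hv (hb hv)) (by omega)
  rfl

theorem start_clause_le (L : Layout φ) (j : Fin m) :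
    (L.start (.clause j)).1 ≤ (m - 1) / 3 ∧ (L.start (.clause j)).2 < 3 := by
  have h1 := (L.room j).1.2
  have h2 := (L.room j).2.2
  simp only [start]
  omega

/-- The cells around the place to which a blocker steps aside. -/
def Near (L : Layout φ) (v : Fin N) (c : ℕ × ℕ) : Prop :=
  L.varCol v + 1 ≤ c.1 ∧ c.1 ≤ L.varCol v + 3 ∧ 1 ≤ c.2

/-- The place to which a blocker steps aside at first. -/
def aside (L : Layout φ) (b : Bool) (v : Fin N) : ℕ × ℕ :=
  if b then (L.varCol v + 3, 2) else (L.varCol v + 2, 1)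

theorem aside_onSide (L : Layout φ) (b : Bool) (v : Fin N) : L.OnSide b v (L.aside b v) := by
  unfold OnSide OnTop OnBottom aside
  cases b <;> simp <;> omega

theorem OnSide.free {L : Layout φ} {b : Bool} {v : Fin N} {c : ℕ × ℕ} (h : L.OnSide b v c) :
    c ∈ L.Free := by
  rcases h with ⟨-, h⟩ | ⟨-, h⟩
  · exact h.free
  · exact h.free

theorem near_aside (L : Layout φ) (b : Bool) (v : Fin N) : L.Near v (L.aside b v) := by
  unfold Near aside
  cases b <;> simp

/-- On either side the blocker stays below the literal agents of its gadget, which start at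
`varLevel v + 6` or higher. -/
theorem height_aside (L : Layout φ) (b : Bool) (v : Fin N) :
    L.height (L.aside b v) = L.varLevel v + 5 := by
  have h := L.near_aside b v
  unfold Near at h
  rw [L.height_inner (v := v) (by omega) (by omega)]
  unfold aside varLevel
  cases b <;> simp <;> ring

/-- The positions after the blockers have stepped aside. -/
def cleared (L : Layout φ) (A : Fin N → Bool) : Agent N m → ℕ × ℕ
  | .blocker v => L.aside (A v) v
  | r => L.start r

theorem cleared_free (L : Layout φ) (A : Fin N → Bool) (r : Agent N m) :
    L.cleared A r ∈ L.Free := by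
  cases r with
  | blocker v => exact (L.aside_onSide (A v) v).free
  | _ => exact L.start_free _

/-- Literal agents start in column 4 or later, so these cells belong to the blocker of `v` alone. -/
theorem near_start_iff (L : Layout φ) (r : Agent N m) (v : Fin N) :
    L.Near v (L.start r) ↔ r = .blocker v := by
  have hv := L.le_varCol v
  unfold Near
  cases r with
  | clause j =>
    have := L.start_clause_le j
    simp only [reduceCtorEq, iff_false]
    omega
  | literal j k =>
    have := L.start_literal_col j k
    simp only [reduceCtorEq, iff_false]
    rcases L.varCol_trichotomy v (φ j k).1 with rfl | h | h <;> omega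
  | blocker w =>
    simp only [start, Agent.blocker.injEq]
    rcases L.varCol_trichotomy w v with rfl | h | h
    · simp
    · exact ⟨fun _ => by omega, by rintro rfl; omega⟩
    · exact ⟨fun _ => by omega, by rintro rfl; omega⟩

theorem near_cleared_iff (L : Layout φ) (A : Fin N → Bool) (r : Agent N m) (v : Fin N) :
    L.Near v (L.cleared A r) ↔ r = .blocker v := by
  cases r with
  | blocker w =>
    have h := L.near_aside (A w) w
    unfold Near at h
    simp only [cleared, Agent.blocker.injEq]
    constructor
    · intro h'
      unfold Near at h'
      rcases L.varCol_trichotomy w v with h | h | h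
      · exact h
      · omega
      · omega
    · rintro rfl
      exact h
  | _ => exact L.near_start_iff _ v

theorem start_injective (L : Layout φ) : Function.Injective L.start := by
  intro r r' h
  cases r' with
  | blocker v => exact (L.near_start_iff r v).1 (h ▸ (L.near_start_iff _ v).2 rfl)
  | clause j =>
    have h' := L.start_clause_le j
    rw [← h] at h'
    cases r with
    | blocker v => exact ((L.near_start_iff (.clause j) v).1 (h ▸ (L.near_start_iff _ v).2 rfl)).symm
    | clause i =>
      simp only [start, Prod.mk.injEq] at h
      rw [L.room.injective (Prod.ext (Fin.ext h.1) (Fin.ext h.2))]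
    | literal i k =>
      have := L.start_literal_col i k
      have := L.le_varCol (φ i k).1
      omega
  | literal j k =>
    cases r with
    | blocker v =>
      exact ((L.near_start_iff (.literal j k) v).1 (h ▸ (L.near_start_iff _ v).2 rfl)).symm
    | clause i =>
      have h' := L.start_clause_le i
      rw [h] at h'
      have := L.start_literal_col j k
      have := L.le_varCol (φ j k).1
      omega
    | literal i l =>
      refine L.literal_eq_of_height_eq (fun _ => ?_) (congrArg L.height h)
      have := congrArg Prod.snd h
      simp only [start] at this
      cases h1 : (φ i l).2 <;> cases h2 : (φ j k).2 <;> simp_all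

theorem start_mem_literalLane (L : Layout φ) {σ : Fin N → Bool} {j : Fin m} {k : Fin 3}
    (h : σ (φ j k).1 = (φ j k).2) : L.inst.src (.literal j k) ∈ L.literalLane σ j k := by
  refine .inl ⟨.of_onSide (v := (φ j k).1) (h ▸ L.start_literal_onSide j k), le_rfl, ?_⟩
  have h1 := (L.zone_le_target_literal j k).1
  have h2 := L.start_literal_col j k
  have h3 := L.varCol_add_le_zone (φ j k).1
  change (L.start (.literal j k)).1 ≤ _
  omega

theorem start_mem_clauseLane (L : Layout φ) (σ : Fin N → Bool) (j : Fin m) (k : Fin 3) :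
    L.inst.src (.clause j) ∈ L.clauseLane σ j k :=
  .inl ⟨(L.start_clause_le j).1, (L.start_clause_le j).2, .inl ⟨rfl, le_rfl⟩⟩

theorem start_mem_blockerLane (L : Layout φ) (σ : Fin N → Bool) (v : Fin N) :
    L.inst.src (.blocker v) ∈ L.blockerLane σ v := by
  have h : L.Shared v (L.start (.blocker v)) := .inl (by simp [start])
  refine ⟨.of_shared h, ?_, ?_⟩
  · change _ ≤ L.height (L.start (.blocker v))
    rw [L.height_inner (v := v)]
    all_goals simp only [start, varLevel]
    all_goals omega
  · change (L.start (.blocker v)).1 ≤ _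
    simp only [start]
    omega

theorem level_le_of_adj (L : Layout φ) (a b : L.Free) (h : L.inst.graph.Adj a b) :
    L.level b ≤ L.level a + 1 := L.height_le_of_adj a.2 b.2 h

/-- Distances ignore the other agents, so any choice of sides will do, except that a literal agent
has to leave its gadget on its own side. -/
theorem dist_eq (L : Layout φ) (r : Agent N m) :
    (L.inst.graph.dist (L.inst.src r) (L.inst.trg r) : ℤ) =
      L.level (L.inst.trg r) - L.level (L.inst.src r) := by
  cases r with
  | clause j =>
    exact (L.isLane_clauseLane (fun _ => true) j 0).dist_eq L.level_le_of_adj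
      (L.start_mem_clauseLane _ j 0)
  | literal j k =>
    exact (L.isLane_literalLane (fun _ => (φ j k).2) j k).dist_eq L.level_le_of_adj
      (L.start_mem_literalLane rfl)
  | blocker v =>
    exact (L.isLane_blockerLane (fun _ => true) v).dist_eq L.level_le_of_adj
      (L.start_mem_blockerLane _ v)

theorem satisfiable_of_cost_eq (L : Layout φ) {p : Agent N m → ℕ → L.Free}
    (hp : L.inst.IsMotionPlan p) (hcf : MAPF.CollisionFree p)
    (hcost : MAPF.cost p = L.inst.dStar) : φ.Satisfiable := by
  refine satisfiable_of_plan hp hcf fun r τ => ?_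
  rcases (hp r).2.2 τ with h | h
  · exact .inl h
  · rcases hp.climbs L.level_le_of_adj L.dist_eq hcost r τ with h' | h'
    · exact .inl h'
    · exact .inr ⟨(p r τ).2, (p r (τ + 1)).2, h, h'⟩

/-! ### A satisfying assignment yields a sequential plan. -/

open Relation

/-- The lane on which a blocker steps aside. -/
def asideLane (L : Layout φ) (A : Fin N → Bool) : Agent N m → Set L.Free
  | .blocker v => {c | c.1 = (L.varCol v + 1, 2) ∨ c.1 = (L.varCol v + 2, 2) ∨
      c.1 = L.aside (A v) v}
  | r => {L.inst.src r}

theorem isLane_asideLane (L : Layout φ) (A : Fin N → Bool) (r : Agent N m) :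
    MAPF.IsLane L.inst.graph L.level (L.asideLane A r) ⟨L.cleared A r, L.cleared_free A r⟩ := by
  cases r with
  | blocker v =>
    have h1 : L.Shared v (L.varCol v + 1, 2) := .inl (by simp)
    have h2 : L.Shared v (L.varCol v + 2, 2) := .inl (by simp)
    refine isLane_of_ascends ?_ ?_
    · rintro ⟨c, hc⟩ (h | h | h) hne
      · refine ⟨(L.varCol v + 2, 2), fun _ => .inr (.inl rfl), ?_⟩
        simp only at h
        subst h
        exact ascends_right hc h2.free rfl rfl
      · refine ⟨L.aside (A v) v, fun _ => .inr (.inr rfl), ?_⟩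
        simp only at h
        subst h
        have hf := (L.aside_onSide (A v) v).free
        cases hA : A v
        · rw [hA] at hf
          exact ascends_down (v := v) hc hf (by simp) (by simp only; omega) rfl rfl
        · rw [hA] at hf
          exact ascends_right hc hf rfl rfl
      · exact absurd (Subtype.ext h) hne
    · intro c hc
      change _ ≤ L.height (L.aside (A v) v)
      rw [height_aside]
      rcases hc with h | h | h
      · rw [h, L.height_inner (v := v)]
        all_goals simp only [varLevel]
        all_goals omega
      · rw [h, L.height_inner (v := v)]
        all_goals simp only [varLevel]
        all_goals omega
      · rw [h, height_aside]
  | clause j => exact ⟨fun c hc h => absurd hc h, fun c hc => le_of_eq (congrArg L.level hc)⟩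
  | literal j k => exact ⟨fun c hc h => absurd hc h, fun c hc => le_of_eq (congrArg L.level hc)⟩

/-- A blocker's lane stays within its `Near` region, and every other lane is a single start cell. -/
theorem not_mem_asideLane (L : Layout φ) (A : Fin N → Bool) {r r' : Agent N m} (hr : r' ≠ r)
    {c : L.Free} (hc : c.1 = L.start r' ∨ c.1 = L.cleared A r') : c ∉ L.asideLane A r := by
  have hnear : ∀ v, L.Near v c ↔ r' = .blocker v := by
    intro v
    rcases hc with hc | hc
    · rw [hc, near_start_iff]
    · rw [hc, near_cleared_iff]
  have hsrc : ∀ a, (∀ v, a ≠ .blocker v) → a ≠ r' → c ≠ L.inst.src a := by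
    rintro a hb ha rfl
    cases r' with
    | blocker v => exact hb v ((L.near_start_iff a v).1 ((hnear v).2 rfl))
    | _ => rcases hc with hc | hc <;> exact ha (L.start_injective hc)
  cases r with
  | blocker v =>
    intro h
    refine hr ((hnear v).1 ?_)
    rcases h with h | h | h
    · rw [h]
      unfold Near
      simp
    · rw [h]
      unfold Near
      simp
    · rw [h]
      exact L.near_aside _ _
  | clause j => exact hsrc (.clause j) (by simp) hr.symm
  | literal j k => exact hsrc (.literal j k) (by simp) hr.symm

theorem reflTransGen_cleared (L : Layout φ) (A : Fin N → Bool) :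
    ReflTransGen (MAPF.Step L.inst.graph L.level) L.inst.src
      (fun r => ⟨L.cleared A r, L.cleared_free A r⟩) := by
  -- With a constant key any order is allowed: no lane contains a start or an end of another agent.
  refine MAPF.reflTransGen_of_lanes (fun _ => 0) (L.asideLane A) _ _ (L.isLane_asideLane A) ?_
    (fun r r' hr _ => L.not_mem_asideLane A hr (.inr rfl))
    (fun r r' hr _ => L.not_mem_asideLane A hr (.inl rfl))
  intro r
  cases r with
  | blocker v => exact .inl rfl
  | _ => exact rfl

/-- The order in which the kinds of agents go to their targets: false literals, clauses,
true literals, blockers. -/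
def phase (φ : CNF3 N m) (A : Fin N → Bool) : Agent N m → ℕ
  | .literal j k => if A (φ j k).1 = (φ j k).2 then 2 else 0
  | .clause _ => 1
  | .blocker _ => 3

theorem phase_literal_le (φ : CNF3 N m) (A : Fin N → Bool) (j : Fin m) (k : Fin 3) :
    phase φ A (.literal j k) ≤ 2 := by
  simp only [phase]
  split_ifs <;> simp

/-- The agents go phase by phase, and those who are ahead go first. -/
noncomputable def key (L : Layout φ) (A : Fin N → Bool) (r : Agent N m) : ℕ ×ₗ ℤ :=
  toLex (phase φ A r, -L.height (L.start r))

theorem key_le_key (L : Layout φ) (A : Fin N → Bool) (r r' : Agent N m) :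
    L.key A r ≤ L.key A r' ↔ phase φ A r < phase φ A r' ∨
      (phase φ A r = phase φ A r' ∧ L.height (L.start r') ≤ L.height (L.start r)) := by
  simp [key, Prod.Lex.toLex_le_toLex]

/-- The sides that a literal agent uses: its own one first, then the ones without blockers. -/
def literalSides (φ : CNF3 N m) (A : Fin N → Bool) (j : Fin m) (k : Fin 3) (u : Fin N) : Bool :=
  if u = (φ j k).1 then (φ j k).2 else !A u

/-- Only blockers follow `A`; all others avoid the side of the blocker, except a literal agent in
its own gadget. -/
def lane (L : Layout φ) (A : Fin N → Bool) (K : Fin m → Fin 3) : Agent N m → Set L.Free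
  | .literal j k => L.literalLane (literalSides φ A j k) j k
  | .clause j => L.clauseLane (fun u => !A u) j (K j)
  | .blocker v => L.blockerLane A v

theorem isLane_lane (L : Layout φ) (A : Fin N → Bool) (K : Fin m → Fin 3) (r : Agent N m) :
    MAPF.IsLane L.inst.graph L.level (L.lane A K r) (L.inst.trg r) := by
  cases r with
  | clause j => exact L.isLane_clauseLane _ j _
  | literal j k => exact L.isLane_literalLane _ j k
  | blocker v => exact L.isLane_blockerLane _ v

theorem cleared_mem_lane (L : Layout φ) (A : Fin N → Bool) (K : Fin m → Fin 3) (r : Agent N m) :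
    (⟨L.cleared A r, L.cleared_free A r⟩ : L.Free) ∈ L.lane A K r := by
  cases r with
  | clause j => exact L.start_mem_clauseLane _ j _
  | literal j k => exact L.start_mem_literalLane (by simp [literalSides])
  | blocker v =>
    refine ⟨.of_onSide (L.aside_onSide (A v) v), ?_, ?_⟩
    · simp only [cleared, height_aside]
      omega
    · have := L.near_aside (A v) v
      unfold Near at this
      simp only [cleared]
      omega

theorem target_literal_injective (L : Layout φ) {i j : Fin m} {k l : Fin 3}
    (h : L.target (.literal i k) = L.target (.literal j l)) : i = j ∧ k = l := by
  have h1 := (L.litPos i k).2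
  have h2 := (L.litPos j l).2
  simp only [target, Prod.mk.injEq, and_true] at h
  rcases L.clauseCol_trichotomy i j with rfl | h' | h'
  · exact ⟨rfl, (L.litPos i).injective (Fin.ext (by omega))⟩
  · omega
  · omega

theorem height_room_le_of_mem_clauseLane (L : Layout φ) {σ : Fin N → Bool} {j : Fin m}
    {k : Fin 3} {c : L.Free} (hc : c ∈ L.clauseLane σ j k) (h : c.1.1 ≤ (m - 1) / 3)
    (hle : L.height c ≤ L.height (L.start (.clause j))) : c.1 = L.start (.clause j) := by
  have hj := room_add_le_zone φ j
  have hz := (L.zone_le_target_literal j k).1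
  have hs := L.start_clause_le j
  rw [L.height_room h, L.height_room hs.1] at hle
  rcases hc with ⟨h1, h2, h3⟩ | ⟨h1, h2, h3⟩ | h1 | ⟨h1, h2, h3⟩
  · exact Prod.ext (by omega) (by omega)
  · omega
  · rw [h1] at h
    omega
  · omega

/-- A literal lane begins at the level of its agent's start, so the blocker of its own gadget and
the literal agents behind are no obstacle; in other gadgets it meets only false literals, which go
in order of level. Clause lanes avoid blockers and true literals, and false ones have left. -/
theorem cleared_not_mem_lane (L : Layout φ) {A : Fin N → Bool} {K : Fin m → Fin 3}
    {r r' : Agent N m} (hr : r' ≠ r) (hkey : L.key A r ≤ L.key A r') :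
    (⟨L.cleared A r', L.cleared_free A r'⟩ : L.Free) ∉ L.lane A K r := by
  rw [key_le_key] at hkey
  have hzone : ∀ r', (L.cleared A r').1 < zone φ ∨ ∃ j, r' = .clause j := by
    intro r'
    cases r' with
    | clause j => exact .inr ⟨j, rfl⟩
    | literal j k =>
      have := L.start_literal_col j k
      have := L.varCol_add_le_zone (φ j k).1
      simp only [cleared]
      omega
    | blocker v =>
      have h := L.near_aside (A v) v
      have := L.varCol_add_le_zone v
      unfold Near at h
      simp only [cleared]
      omega
  cases r with
  | literal j k =>
    have hz := (L.zone_le_target_literal j k).1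
    have hb := L.height_start_literal_bounds j k
    have hvc := L.le_varCol (φ j k).1
    have hj := room_add_le_zone φ j
    rintro (⟨h1, h2, -⟩ | h1)
    · cases r' with
      | clause i =>
        have hs := L.start_clause_le i
        simp only [cleared, L.height_room hs.1] at h2
        unfold varLevel at hb
        omega
      | literal i l =>
        -- The road decides the truth value of the literal met: in the own gadget it equals that of
        -- the moving literal, elsewhere it is false. Either way the phases agree and the levels
        -- must coincide.
        have hside := h1.eq_of_onSide (L.start_literal_onSide i l)
        refine hr.symm (L.literal_eq_of_height_eq (fun hv => ?_) ?_)
        · rw [← hside, literalSides, if_pos hv.symm]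
        · refine le_antisymm h2 ?_
          simp only [phase] at hkey
          by_cases hv : (φ i l).1 = (φ j k).1
          · rw [literalSides, if_pos hv] at hside
            rw [hv, hside] at hkey
            omega
          · rw [literalSides, if_neg hv] at hside
            have : ¬ A (φ i l).1 = (φ i l).2 := by
              rw [← hside]
              simp
            rw [if_neg this] at hkey
            split_ifs at hkey <;> omega
      | blocker v =>
        have hside := h1.eq_of_onSide (L.aside_onSide (A v) v)
        simp only [cleared, height_aside] at h2
        by_cases hv : v = (φ j k).1
        · subst hv
          omega
        · rw [literalSides, if_neg hv] at hside
          simp at hside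
    · rcases hzone r' with h | ⟨i, rfl⟩
      · rw [show L.cleared A r' = _ from h1] at h
        omega
      · have hs := L.start_clause_le i
        have h1' : L.start (.clause i) = L.target (.literal j k) := h1
        rw [h1'] at hs
        omega
  | clause j =>
    have hz := (L.zone_le_target_literal j (K j)).1
    have hj := room_add_le_zone φ j
    intro hmem
    cases r' with
    | clause i =>
      have hs := L.start_clause_le i
      simp only [phase, lt_irrefl, false_or, true_and] at hkey
      exact hr (L.start_injective (L.height_room_le_of_mem_clauseLane hmem hs.1 hkey))
    | literal i l =>
      have hs := L.start_literal_col i l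
      have hvc := L.le_varCol (φ i l).1
      have hzl := hzone (.literal i l)
      simp only [cleared, reduceCtorEq, exists_false, or_false] at hzl
      rcases hmem with ⟨h1, h2, h3⟩ | ⟨h1, h2, h3⟩ | h1 | ⟨h1, h2, h3⟩
      · simp only [cleared] at h1
        omega
      · have hside := h1.eq_of_onSide (L.start_literal_onSide i l)
        simp only [phase] at hkey
        have : ¬ A (φ i l).1 = (φ i l).2 := by
          rw [← hside]
          simp
        rw [if_neg this] at hkey
        omega
      · simp only [cleared] at h1
        rw [h1] at hzl
        omega
      · simp only [cleared] at h2
        omega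
    | blocker v =>
      have hs := L.near_aside (A v) v
      unfold Near at hs
      have hvc := L.le_varCol v
      have hzl := hzone (.blocker v)
      simp only [cleared, reduceCtorEq, exists_false, or_false] at hzl
      rcases hmem with ⟨h1, h2, h3⟩ | ⟨h1, h2, h3⟩ | h1 | ⟨h1, h2, h3⟩
      · simp only [cleared] at h1
        omega
      · have hside := h1.eq_of_onSide (L.aside_onSide (A v) v)
        simp at hside
      · simp only [cleared] at h1
        rw [h1] at hzl
        omega
      · simp only [cleared] at h2
        omega
  | blocker v =>
    rintro ⟨h1, h2, h3⟩
    cases r' with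
    | clause i =>
      simp [phase] at hkey
    | literal i l =>
      have h1 := phase_literal_le φ A i l
      have h2 : phase φ A (.blocker v) = 3 := rfl
      omega
    | blocker w =>
      have hs := L.near_aside (A w) w
      unfold Near at hs
      simp only [cleared, height_aside] at h2 h3
      rcases L.varCol_trichotomy v w with rfl | h | h
      · exact hr rfl
      · omega
      · unfold varLevel at h2
        omega

/-- Roads use only the bottom row of the clause gadgets, which contains no target, and blockers
reach their exits last. -/
theorem target_not_mem_lane (L : Layout φ) {A : Fin N → Bool} {K : Fin m → Fin 3}
    (hK : ∀ j, A (φ j (K j)).1 = (φ j (K j)).2)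
    {r r' : Agent N m} (hr : r' ≠ r) (hkey : L.key A r' ≤ L.key A r) :
    L.inst.trg r' ∉ L.lane A K r := by
  rw [key_le_key] at hkey
  have hlz : ∀ i l, zone φ ≤ (L.target (.literal i l)).1 :=
    fun i l => (L.zone_le_target_literal i l).1
  have hcz : ∀ i, zone φ ≤ (L.target (.clause i)).1 := by
    intro i
    have := L.zone_le_clauseCol i
    simp only [target]
    omega
  cases r with
  | literal j k =>
    cases r' with
    | clause i =>
      rintro (⟨h1, -, -⟩ | h1)
      · exact absurd (h1.snd_eq_zero (hcz i)) (by simp [inst, target])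
      · simp [inst, target] at h1
    | literal i l =>
      rintro (⟨h1, -, -⟩ | h1)
      · exact absurd (h1.snd_eq_zero (hlz i l)) (by simp [inst, target])
      · obtain ⟨rfl, rfl⟩ := L.target_literal_injective h1
        exact hr rfl
    | blocker v =>
      have h1 := phase_literal_le φ A j k
      have h2 : phase φ A (.blocker v) = 3 := rfl
      omega
  | clause j =>
    have hj := room_add_le_zone φ j
    cases r' with
    | clause i =>
      have hzi := hcz i
      rintro (⟨h1, -, -⟩ | ⟨h1, -, -⟩ | h1 | ⟨-, h2, h3⟩)
      · change (L.target (.clause i)).1 ≤ _ at h1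
        omega
      · exact absurd (h1.snd_eq_zero (hcz i)) (by simp [inst, target])
      · simp [inst, target] at h1
      · simp only [inst, target] at h2 h3
        rcases L.clauseCol_trichotomy i j with rfl | h | h
        · exact hr rfl
        · omega
        · omega
    | literal i l =>
      have hzi := hlz i l
      rintro (⟨h1, -, -⟩ | ⟨h1, -, -⟩ | h1 | ⟨h1, -, -⟩)
      · change (L.target (.literal i l)).1 ≤ _ at h1
        omega
      · exact absurd (h1.snd_eq_zero (hlz i l)) (by simp [inst, target])
      · obtain ⟨rfl, rfl⟩ := L.target_literal_injective h1
        -- The one literal target on the clause lane belongs to a true literal, whose agent goes in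
        -- a later phase.
        simp [phase, hK] at hkey
      · simp [inst, target] at h1
    | blocker v =>
      simp [phase] at hkey
  | blocker v =>
    have hv := L.varCol_add_le_zone v
    rintro ⟨h1, h2, h3⟩
    cases r' with
    | clause i =>
      have hzi := hcz i
      change (L.target (.clause i)).1 ≤ _ at h3
      omega
    | literal i l =>
      have hzi := hlz i l
      change (L.target (.literal i l)).1 ≤ _ at h3
      omega
    | blocker w =>
      change (L.target (.blocker w)).1 ≤ _ at h3
      have h2' := h2.trans (height_le_of_le_exit (v := w) (c := L.target (.blocker w))
        (L.target_free (.blocker w))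
        (by simp only [target]; omega))
      simp only [target] at h3
      rcases L.varLevel_trichotomy v w with rfl | h | h
      · exact hr rfl
      · rcases L.varCol_trichotomy v w with rfl | h | h
        · exact hr rfl
        · omega
        · unfold varLevel at *
          omega
      · omega

theorem exists_plan (L : Layout φ) (h : φ.Satisfiable) :
    ∃ p : Agent N m → ℕ → L.Free, L.inst.IsMotionPlan p ∧ MAPF.CollisionFree p ∧
      MAPF.Sequential p ∧ MAPF.cost p = L.inst.dStar := by
  obtain ⟨A, hA⟩ := h
  choose K hK using hA
  have hst := (L.reflTransGen_cleared A).trans <|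
    MAPF.reflTransGen_of_lanes (L.key A) (L.lane A K) _ L.inst.trg (L.isLane_lane A K)
      (L.cleared_mem_lane A K) (fun r r' hr hkey => L.target_not_mem_lane hK hr hkey)
      (fun r r' hr hkey => L.cleared_not_mem_lane hr hkey)
  obtain ⟨p, h1, h2, h3, h4⟩ := MAPF.exists_sequential_plan L.inst
    (fun r r' e => L.start_injective (congrArg Subtype.val e)) hst
  refine ⟨p, h1, h2, h3, Finset.sum_congr rfl fun r _ => ?_⟩
  have := h4 r
  rw [← L.dist_eq r] at this
  exact_mod_cast this

end Layout

theorem theorem2 {N m : ℕ} (φ : CNF3 N m) (L : Layout φ) :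
    ((∃ p : Agent N m → ℕ → L.Free, L.inst.IsMotionPlan p ∧ MAPF.CollisionFree p ∧
        MAPF.cost p = L.inst.dStar) ↔ φ.Satisfiable) ∧
    ((∃ p : Agent N m → ℕ → L.Free, L.inst.IsMotionPlan p ∧ MAPF.CollisionFree p ∧
        MAPF.Sequential p ∧ MAPF.cost p = L.inst.dStar) ↔ φ.Satisfiable) := by
  refine ⟨⟨?_, fun h => ?_⟩, ⟨?_, L.exists_plan⟩⟩
  · rintro ⟨p, h1, h2, h3⟩
    exact L.satisfiable_of_cost_eq h1 h2 h3
  · obtain ⟨p, h1, h2, -, h3⟩ := L.exists_plan h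
    exact ⟨p, h1, h2, h3⟩
  · rintro ⟨p, h1, h2, -, h3⟩
    exact L.satisfiable_of_cost_eq h1 h2 h3
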